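/- **Proposition (Local linear convergence of Prox-SVRG).** Consider $\min_{x\in\mathbb R^n}\Phi(x)=R(x)+F(x)$ with $F=\frac1m\sum_{i=1}^m f_i$, where $R:\mathbb R^n\to\mathbb R\cup\{+\infty\}$ is proper, convex and lower semicontinuous, each $f_i:\mathbb R^n\to\mathbb R$ is convex and differentiable with $L_i$-Lipschitz gradient, $L=\max_i L_i$, and $\operatorname{Argmin}\Phi\ne\emptyset$. Let $P\ge1$ be an integer and let $\gamma>0$ satisfy $4L\gamma(P+1)<1$ (in particular, $\gamma\le\frac1{4L(P+2)}$ is allowed when $L>0$). From an arbitrary $\tilde x_0\in\mathbb R^n$, run Prox-SVRG with Option I: for $\ell=0,1,2,\dots$ put $x_{\ell,0}=\tilde x_\ell$; for $p=1,\dots,P$ let $$x_{\ell,p}=\operatorname{prox}_{\gamma R}\Big(x_{\ell,p-1}-\gamma\big(\nabla f_{i}(x_{\ell,p-1})-\nabla f_{i}(\tilde x_\ell)+\tfrac1m\textstyle\sum_{j}\nabla f_j(\tilde x_\ell)\big)\Big),$$ where $\operatorname{prox}_{\gamma R}(z)=\operatorname{argmin}_y\{\gamma R(y)+\frac12\|y-z\|^2\}$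 and $i=i_{\ell,p}$ are independent and uniform on $\{1,\dots,m\}$; and put $\tilde x_{\ell+1}=x_{\ell,P}$. Write $x_k=x_{\ell,p}$ for $k=\ell P+p$. 1. Almost surely, $(x_k)$ converges to a point of $\operatorname{Argmin}\Phi$ (which may depend on the realisation). 2. Let $x^\star\in\operatorname{Argmin}\Phi$, let $T=\operatorname{par}(\partial R(x^\star))^\perp$, where $\operatorname{par}$ denotes the linear subspace parallel to the affine hull, and suppose that: * $R$ is partly smooth at $x^\star$ relative to a set $\mathcal M\ni x^\star$: $\partial R(x^\star)\neq\emptyset$; around $x^\star$ the set $\mathcal M$ is an embedded $C^2$-submanifold and $R|_{\mathcal M}$ is $C^2$; the tangent space of $\mathcal M$ at $x^\star$ is $T$; and $\partial R$ is continuous (inner and outer semicontinuous) at $x^\star$ relative to $\mathcal M$; * (ND) $-\nabla F(x^\star)\in\operatorname{ri}(\partial R(x^\star))$; * (RI) $F$ is $C^2$ around $x^\star$ and $\ker\nabla^2F(x^\star)\cap T=\{0\}$. Then $x_k\to x^\star$ almost surely. Moreover, there is an $\alpha_F>0$ for which the following condition (a) holds. Let $\alpha_F,\alpha_R\ge0$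 be any constants such that, for some $r>0$, (a) $\langle h,\nabla^2F(x)h\rangle\ge\alpha_F\|h\|^2$ for all $h\in T$ and all $x$ with $\|x-x^\star\|\le r$; (b) $R(y)\ge R(x)+\langle v,y-x\rangle+\frac{\alpha_R}2\|y-x\|^2$ for all $x,y\in\mathcal M$ with $\|x-x^\star\|,\|y-x^\star\|\le r$ and all $v\in\partial R(x)$ (e.g. $\alpha_R=0$, or a strong convexity modulus of $R$). If $$\rho=\max\Big\{\frac{1-\gamma\alpha_F}{1+\gamma\alpha_R},\,4L\gamma(P+1)\Big\}<1,$$ then there exist an integer $K>0$ and a constant $C$ such that $\|\tilde x_\ell-x^\star\|^2$ is integrable and $\mathbb E\|\tilde x_\ell-x^\star\|^2\le C\rho^{\ell-K}$ for all $\ell\ge K$. -/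

import Mathlib

open MeasureTheory ProbabilityTheory Filter Topology
open scoped NNReal

noncomputable section

section Convex

variable {E : Type*} [NormedAddCommGroup E] [InnerProductSpace ℝ E]

/-- `R : E → ℝ ∪ {+∞}` is proper, convex (its epigraph is convex) and lower semicontinuous.
The value `-∞` is excluded by `ne_bot`. -/
structure IsProperConvexLsc (R : E → EReal) : Prop where
  ne_bot : ∀ x, R x ≠ ⊥
  exists_finite : ∃ x, R x ≠ ⊤
  convex_epi : Convex ℝ {q : E × ℝ | R q.1 ≤ (q.2 : EReal)}
  lsc : LowerSemicontinuous R

/-- The convex subdifferential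
`∂R(x) = {g | ∀ y, R y ≥ R x + ⟪g, y - x⟫}`. -/
def subdiff (R : E → EReal) (x : E) : Set E :=
  {g | ∀ y, R x + ((inner ℝ g (y - x) : ℝ) : EReal) ≤ R y}

/-- `T_x`, the orthogonal complement of the linear subspace parallel to the affine hull
of `∂R(x)`. -/
def modelSubspace (R : E → EReal) (x : E) : Submodule ℝ E :=
  (vectorSpan ℝ (subdiff R x))ᗮ

/-- `x` is the proximal point of `z`: it minimises `y ↦ γ R(y) + ‖y - z‖² / 2`. -/
def IsProx (R : E → EReal) (γ : ℝ) (z x : E) : Prop :=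
  ∀ y, (γ : EReal) * R x + ((‖x - z‖ ^ 2 / 2 : ℝ) : EReal)
    ≤ (γ : EReal) * R y + ((‖y - z‖ ^ 2 / 2 : ℝ) : EReal)

/-- `G` is a local `C²` defining map of the set `M` around `x`: near `x` the set `M` is the zero
set of the submersion `G`. The tangent space of `M` at `x` is then `ker DG(x)`
(for every such `G`). -/
structure IsLocalDefiningMap (M : Set E) (x : E) {c : ℕ}
    (G : E → EuclideanSpace ℝ (Fin c)) : Prop where
  contDiffAt : ContDiffAt ℝ 2 G x
  surjective : Function.Surjective (fderiv ℝ G x)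
  mem_iff : ∀ᶠ y in 𝓝 x, y ∈ M ↔ G y = 0

/-- `R` is partly smooth at `x` relative to `M`. -/
structure PartlySmooth (R : E → EReal) (x : E) (M : Set E) : Prop where
  mem : x ∈ M
  subdiff_nonempty : (subdiff R x).Nonempty
  /-- Sharpness: `M` is an embedded `C²` submanifold around `x`, whose tangent space at `x` is
  `T_x`. -/
  manifold_sharp : ∃ (c : ℕ) (G : E → EuclideanSpace ℝ (Fin c)), IsLocalDefiningMap M x G ∧
    (fderiv ℝ G x : E →ₗ[ℝ] EuclideanSpace ℝ (Fin c)).ker = modelSubspace R x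
  /-- Smoothness: `R` restricted to `M` is `C²` around `x`. -/
  smooth : ∃ S : E → ℝ, ContDiffAt ℝ 2 S x ∧ ∀ᶠ y in 𝓝 x, y ∈ M → R y = (S y : EReal)
  /-- Inner semicontinuity of `∂R` at `x` relative to `M`. -/
  inner_continuous : ∀ v ∈ subdiff R x, ∀ ε > 0,
    ∀ᶠ y in 𝓝[M] x, ∃ w ∈ subdiff R y, ‖w - v‖ < ε
  /-- Outer semicontinuity of `∂R` at `x` relative to `M`. -/
  outer_continuous : ∀ v, (∀ ε > 0, ∃ᶠ y in 𝓝[M] x, ∃ w ∈ subdiff R y, ‖w - v‖ < ε) →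
    v ∈ subdiff R x

/-- `α` is a modulus of strong convexity of `R` along `M` around `x₀`. Every (global or local)
modulus of strong convexity of `R` has this property, and so does `α = 0`. -/
def IsStrongModulusAlong (R : E → EReal) (M : Set E) (x₀ : E) (α : ℝ) : Prop :=
  ∃ r > 0, ∀ x ∈ M, ∀ y ∈ M, ‖x - x₀‖ ≤ r → ‖y - x₀‖ ≤ r → ∀ v ∈ subdiff R x,
    R x + ((inner ℝ v (y - x) + α / 2 * ‖y - x‖ ^ 2 : ℝ) : EReal) ≤ R y

end Convex

section FiniteSum

variable {E : Type*} [NormedAddCommGroup E] [InnerProductSpace ℝ E] {m : ℕ}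

/-- `F = (1/m) ∑ᵢ fᵢ`. -/
def avg (f : Fin m → E → ℝ) (x : E) : ℝ := (1 / (m : ℝ)) * ∑ i, f i x

/-- `Φ = R + F`. -/
def objective (R : E → EReal) (f : Fin m → E → ℝ) (x : E) : EReal :=
  R x + (avg f x : EReal)

/-- The set of (global) minimisers of `Φ`. -/
def argmin (Φ : E → EReal) : Set E := {x | ∀ y, Φ x ≤ Φ y}

variable [CompleteSpace E]

/-- The Hessian `∇²F(x)` as a linear operator, the derivative of the gradient of `F`. -/
def hessian (F : E → ℝ) (x : E) : E →L[ℝ] E := fderiv ℝ (gradient F) x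

/-- Restricted injectivity on the subspace `T`: `F` is `C²` around `x₀` and
`ker ∇²F(x₀) ∩ T = {0}`. -/
def RestrictedInjectivity (F : E → ℝ) (T : Submodule ℝ E) (x₀ : E) : Prop :=
  ContDiffAt ℝ 2 F x₀ ∧ (hessian F x₀ : E →ₗ[ℝ] E).ker ⊓ T = ⊥

/-- `⟪h, ∇²F(x) h⟫ ≥ α ‖h‖²` for all `h ∈ T` and all `x` in a ball around `x₀`. -/
def IsRestrictedModulus (F : E → ℝ) (T : Submodule ℝ E) (x₀ : E) (α : ℝ) : Prop :=
  ∃ r > 0, ∀ x, ‖x - x₀‖ ≤ r → ∀ h ∈ T, α * ‖h‖ ^ 2 ≤ inner ℝ h (hessian F x h)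

/-- A run of Prox-SVRG (Option I) with constant step size `γ`, inner loop length `P`, starting
point `a` and sampled indices `i`: `x ℓ p` is the inner iterate `x_{ℓ,p}`, `0 ≤ p ≤ P`, and
`x ℓ 0` is the outer iterate `x̃_ℓ`. The index used to compute `x_{ℓ,p+1}` is `i (ℓ P + p)`. -/
structure IsProxSVRG (R : E → EReal) (f : Fin m → E → ℝ) (γ : ℝ) (P : ℕ) (a : E)
    (i : ℕ → Fin m) (x : ℕ → ℕ → E) : Prop where
  init : x 0 0 = a
  step : ∀ ℓ p, p < P → IsProx R γ
    (x ℓ p - γ • (gradient (f (i (ℓ * P + p))) (x ℓ p) - gradient (f (i (ℓ * P + p))) (x ℓ 0)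
      + (1 / (m : ℝ)) • ∑ j, gradient (f j) (x ℓ 0)))
    (x ℓ (p + 1))
  next : ∀ ℓ, x (ℓ + 1) 0 = x ℓ P

end FiniteSum

/-- The rate `ρ = max {(1 - γ α_F) / (1 + γ α_R), 4 L γ (P + 1)}`. -/
def svrgRate (L γ αF αR : ℝ) (P : ℕ) : ℝ :=
  max ((1 - γ * αF) / (1 + γ * αR)) (4 * L * γ * (P + 1))

end

/-! ### Subgradients and proximal points of an extended-valued convex function. -/

section ConvexAnalysis

variable {E : Type*} [NormedAddCommGroup E] [InnerProductSpace ℝ E] {R : E → EReal} {γ : ℝ}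

/-! Almost sure convergence. One proximal step with a perturbed gradient satisfies the standard
three-point inequality (`prox_step`). Averaged over the sampled index, the perturbation has mean
zero and variance at most `L²‖x - a‖²`, with `a` the snapshot of the current inner loop
(`sum_prox_step_le`). This distance is controlled by the squared inner steps, so with `κ = 4Lγ(P+1)
< 1` an inner loop costs noise `κ²/8` times the sum of squared steps, while it gains `3/4` times
that sum (`IsSVRGProcess.setIntegral_epoch_le`). Hence the squared distance to a minimiser plus the
accumulated decrease is a nonnegative supermartingale (`IsSVRGProcess.ae_fejer`). Applying this to a
countable dense set of minimisers leaves one null set, off which Opial's argument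
(`exists_tendsto_of_fejer`) gives the limit.

Local rate. The difficulty is that almost sure identification gives a random identification time,
whereas the bound concerns an expectation with a deterministic `K`. The way out is that the step
condition makes the objective decrease over an inner loop in every realisation (`IsEpoch.gap_le`).
Nondegeneracy and restricted injectivity yield quadratic growth (`exists_quadratic_growth`), hence
bounded sublevel sets, and then the excess satisfies `D (n+1)² ≤ C (D n - D (n+1))` with `C`
independent of the realisation. So all realisations are near `xs` after a common number of loops
(`exists_uniform_epoch`), and `PartlySmooth.identification` puts all later inner iterates on the
manifold.

The first step of each loop is noise free, since iterate and snapshot coincide. On the manifold it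
contracts with factor `(1 - γ αF)/(1 + γ αR)` (`exists_contraction_ball`): the small curvature
errors are paid for by quadratic growth. The other steps do not expand in expectation, up to `κ²/8`
times the first squared step (`IsSVRGProcess.integral_next_le`). `contraction_of_step` merges the
two effects into the maximum that defines the rate. -/

lemma IsProperConvexLsc.coe_toReal (hR : IsProperConvexLsc R) {x : E} (hx : R x ≠ ⊤) :
    ((R x).toReal : EReal) = R x := EReal.coe_toReal hx (hR.ne_bot x)

lemma IsProperConvexLsc.le_combo (hR : IsProperConvexLsc R) {x y : E} (hx : R x ≠ ⊤)
    (hy : R y ≠ ⊤) {t : ℝ} (h0 : 0 ≤ t) (h1 : t ≤ 1) :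
    R (x + t • (y - x)) ≤ (((R x).toReal + t * ((R y).toReal - (R x).toReal) : ℝ) : EReal) := by
  have hxm : (x, (R x).toReal) ∈ {q : E × ℝ | R q.1 ≤ (q.2 : EReal)} :=
    (hR.coe_toReal hx).ge
  have hym : (y, (R y).toReal) ∈ {q : E × ℝ | R q.1 ≤ (q.2 : EReal)} :=
    (hR.coe_toReal hy).ge
  have h := hR.convex_epi hxm hym (sub_nonneg.2 h1) h0 (by ring)
  have e1 : (1 - t) • x + t • y = x + t • (y - x) := by module
  have e2 : (1 - t) • (R x).toReal + t • (R y).toReal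
      = (R x).toReal + t * ((R y).toReal - (R x).toReal) := by
    simp only [smul_eq_mul]; ring
  change R ((1 - t) • x + t • y) ≤ (((1 - t) • (R x).toReal + t • (R y).toReal : ℝ) : EReal) at h
  rwa [e1, e2] at h

lemma IsProperConvexLsc.combo_ne_top (hR : IsProperConvexLsc R) {x y : E} (hx : R x ≠ ⊤)
    (hy : R y ≠ ⊤) {t : ℝ} (h0 : 0 ≤ t) (h1 : t ≤ 1) : R (x + t • (y - x)) ≠ ⊤ :=
  ((hR.le_combo hx hy h0 h1).trans_lt (EReal.coe_lt_top _)).ne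

lemma IsProperConvexLsc.toReal_combo_le (hR : IsProperConvexLsc R) {x y : E} (hx : R x ≠ ⊤)
    (hy : R y ≠ ⊤) {t : ℝ} (h0 : 0 ≤ t) (h1 : t ≤ 1) :
    (R (x + t • (y - x))).toReal ≤ (R x).toReal + t * ((R y).toReal - (R x).toReal) := by
  have h := hR.le_combo hx hy h0 h1
  rwa [← hR.coe_toReal (hR.combo_ne_top hx hy h0 h1), EReal.coe_le_coe_iff] at h

lemma subdiff_real (hR : IsProperConvexLsc R) {x y g : E} (hg : g ∈ subdiff R x)
    (hx : R x ≠ ⊤) (hy : R y ≠ ⊤) : (R x).toReal + inner ℝ g (y - x) ≤ (R y).toReal := by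
  have h := hg y
  rw [← hR.coe_toReal hx, ← hR.coe_toReal hy, ← EReal.coe_add] at h
  exact_mod_cast h

lemma mem_subdiff_of_real (hR : IsProperConvexLsc R) {x g : E} (hx : R x ≠ ⊤)
    (h : ∀ y, R y ≠ ⊤ → (R x).toReal + inner ℝ g (y - x) ≤ (R y).toReal) :
    g ∈ subdiff R x := by
  intro y
  by_cases hy : R y = ⊤
  · simp [hy]
  · rw [← hR.coe_toReal hx, ← hR.coe_toReal hy, ← EReal.coe_add]
    exact_mod_cast h y hy

lemma ne_top_of_mem_subdiff (hR : IsProperConvexLsc R) {x g : E} (hg : g ∈ subdiff R x) :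
    R x ≠ ⊤ := by
  intro hx
  obtain ⟨y, hy⟩ := hR.exists_finite
  have h := hg y
  rw [hx, EReal.top_add_coe, top_le_iff] at h
  exact hy h

lemma subdiff_monotone (hR : IsProperConvexLsc R) {x y v w : E} (hv : v ∈ subdiff R x)
    (hw : w ∈ subdiff R y) : 0 ≤ inner ℝ (v - w) (x - y) := by
  have hx := ne_top_of_mem_subdiff hR hv
  have hy := ne_top_of_mem_subdiff hR hw
  have h1 := subdiff_real hR hv hx hy
  have h2 := subdiff_real hR hw hy hx
  have e : inner ℝ v (y - x) = - inner ℝ v (x - y) := by rw [← inner_neg_right, neg_sub]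
  rw [inner_sub_left]
  linarith

/-- Fermat's rule for the sum of a convex function and a differentiable one. -/
lemma neg_gradient_mem_subdiff [CompleteSpace E] (hR : IsProperConvexLsc R) {h : E → ℝ} {g x : E}
    (hg : HasGradientAt h g x) (hx : R x ≠ ⊤)
    (hmin : ∀ y, R y ≠ ⊤ → (R x).toReal + h x ≤ (R y).toReal + h y) : -g ∈ subdiff R x := by
  refine mem_subdiff_of_real hR hx fun y hy => ?_
  set c := (R y).toReal - (R x).toReal
  have hd : HasDerivAt (fun t : ℝ => h (x + t • (y - x))) (inner ℝ g (y - x)) 0 := by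
    have h1 : HasDerivAt (fun t : ℝ => x + t • (y - x)) (y - x) 0 := by
      simpa using ((hasDerivAt_id (0 : ℝ)).smul_const (y - x)).const_add x
    have h2 : HasFDerivAt h (InnerProductSpace.toDual ℝ E g) (x + (0 : ℝ) • (y - x)) := by
      simpa using hg.hasFDerivAt
    simpa [Function.comp_def] using h2.comp_hasDerivAt (0 : ℝ) h1
  have hs := hd.tendsto_slope_zero_right
  -- Minimality at `x + t • (y - x)` together with convexity of `R` along the segment bounds the
  -- difference quotients of `h` below by `-c`; the one-sided limit keeps the bound.
  have hle : ∀ᶠ t : ℝ in 𝓝[>] 0,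
      -c ≤ t⁻¹ • (h (x + (0 + t) • (y - x)) - h (x + (0 : ℝ) • (y - x))) := by
    filter_upwards [Ioo_mem_nhdsGT (zero_lt_one (α := ℝ))] with t ht
    have h1 := hR.toReal_combo_le hx hy ht.1.le ht.2.le
    have h2 := hmin _ (hR.combo_ne_top hx hy ht.1.le ht.2.le)
    rw [smul_eq_mul, inv_mul_eq_div, le_div_iff₀ ht.1]
    simp only [zero_add, zero_smul, add_zero]
    nlinarith
  have := ge_of_tendsto hs hle
  rw [inner_neg_left]
  linarith [show c = (R y).toReal - (R x).toReal from rfl]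

lemma IsProx.ne_top (hR : IsProperConvexLsc R) (hγ : 0 < γ) {z x : E} (h : IsProx R γ z x) :
    R x ≠ ⊤ := by
  intro hx
  obtain ⟨y, hy⟩ := hR.exists_finite
  have h1 := h y
  rw [hx, EReal.coe_mul_top_of_pos hγ, EReal.top_add_coe, top_le_iff,
    ← hR.coe_toReal hy, ← EReal.coe_mul, ← EReal.coe_add] at h1
  exact EReal.coe_ne_top _ h1

lemma isProx_of_real (hR : IsProperConvexLsc R) (hγ : 0 < γ) {z x : E} (hx : R x ≠ ⊤)
    (h : ∀ y, R y ≠ ⊤ → γ * (R x).toReal + ‖x - z‖ ^ 2 / 2 ≤ γ * (R y).toReal + ‖y - z‖ ^ 2 / 2) :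
    IsProx R γ z x := by
  intro y
  by_cases hy : R y = ⊤
  · rw [hy, EReal.coe_mul_top_of_pos hγ, EReal.top_add_coe]; exact le_top
  · rw [← hR.coe_toReal hx, ← hR.coe_toReal hy, ← EReal.coe_mul, ← EReal.coe_mul,
      ← EReal.coe_add, ← EReal.coe_add]
    exact_mod_cast h y hy

lemma IsProx.real (hR : IsProperConvexLsc R) (hγ : 0 < γ) {z x y : E} (h : IsProx R γ z x)
    (hy : R y ≠ ⊤) : γ * (R x).toReal + ‖x - z‖ ^ 2 / 2 ≤ γ * (R y).toReal + ‖y - z‖ ^ 2 / 2 := by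
  have h1 := h y
  rw [← hR.coe_toReal (h.ne_top hR hγ), ← hR.coe_toReal hy, ← EReal.coe_mul, ← EReal.coe_mul,
      ← EReal.coe_add, ← EReal.coe_add] at h1
  exact_mod_cast h1

lemma hasGradientAt_half_sq [CompleteSpace E] (c : ℝ) (z x : E) :
    HasGradientAt (fun y => c * (‖y - z‖ ^ 2 / 2)) (c • (x - z)) x := by
  rw [hasGradientAt_iff_hasFDerivAt]
  have h1 : HasFDerivAt (fun y : E => y - z) (ContinuousLinearMap.id ℝ E) x :=
    (hasFDerivAt_id x).sub_const z
  have h2 := (h1.norm_sq.const_mul (c / 2))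
  refine (h2.congr_fderiv ?_).congr_of_eventuallyEq (Eventually.of_forall fun y => ?_)
  · ext v
    simp
    ring
  · simp only; ring

lemma IsProx.mem_subdiff [CompleteSpace E] (hR : IsProperConvexLsc R) (hγ : 0 < γ) {z x : E}
    (h : IsProx R γ z x) : γ⁻¹ • (z - x) ∈ subdiff R x := by
  have h1 := neg_gradient_mem_subdiff hR (hasGradientAt_half_sq γ⁻¹ z x) (h.ne_top hR hγ)
    (fun y hy => by
      have h2 := h.real hR hγ hy
      have h3 := mul_le_mul_of_nonneg_left h2 (inv_nonneg.2 hγ.le)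
      rw [mul_add, mul_add, inv_mul_cancel_left₀ hγ.ne', inv_mul_cancel_left₀ hγ.ne'] at h3
      exact h3)
  rwa [← smul_neg, neg_sub] at h1

/-- Monotonicity of the subdifferential gives `‖x - x'‖² ≤ ⟪z - z', x - x'⟫`; Cauchy–Schwarz
finishes. -/
lemma IsProx.norm_sub_le [CompleteSpace E] (hR : IsProperConvexLsc R) (hγ : 0 < γ)
    {z z' x x' : E} (h : IsProx R γ z x) (h' : IsProx R γ z' x') : ‖x - x'‖ ≤ ‖z - z'‖ := by
  have h1 := subdiff_monotone hR (h.mem_subdiff hR hγ) (h'.mem_subdiff hR hγ)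
  rw [← smul_sub, inner_smul_left] at h1
  have h2 : 0 ≤ inner ℝ (z - x - (z' - x')) (x - x') :=
    nonneg_of_mul_nonneg_right h1 (by simpa using hγ)
  rw [show z - x - (z' - x') = (z - z') - (x - x') by abel, inner_sub_left,
    real_inner_self_eq_norm_sq] at h2
  have h3 := real_inner_le_norm (z - z') (x - x')
  by_contra! hc
  nlinarith [norm_nonneg (z - z'), norm_nonneg (x - x')]

/-- Uniqueness is what makes the iterates functions of the sampled indices, although the algorithm
is specified only by a relation. -/
lemma IsProx.unique [CompleteSpace E] (hR : IsProperConvexLsc R) (hγ : 0 < γ)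
    {z x x' : E} (h : IsProx R γ z x) (h' : IsProx R γ z x') : x = x' := by
  have := h.norm_sub_le hR hγ h'
  rw [sub_self, norm_zero] at this
  exact sub_eq_zero.1 (norm_le_zero_iff.1 this)

/-- Proximal points exist as soon as `R` has an affine minorant, here given by a subgradient. -/
lemma exists_isProx [FiniteDimensional ℝ E] (hR : IsProperConvexLsc R) (hγ : 0 < γ)
    {x₀ v : E} (hv : v ∈ subdiff R x₀) (z : E) : ∃ x, IsProx R γ z x := by
  have : ProperSpace E := FiniteDimensional.proper ℝ E
  have hx₀ := ne_top_of_mem_subdiff hR hv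
  set q : E → ℝ := fun y => γ⁻¹ * (‖y - z‖ ^ 2 / 2) with hq
  have hqc : Continuous q := by fun_prop
  have hlsc : LowerSemicontinuous fun y => R y + (q y : EReal) := by
    refine hR.lsc.add' (continuous_coe_real_ereal.comp hqc).lowerSemicontinuous fun y => ?_
    exact EReal.continuousAt_add (Or.inr (EReal.coe_ne_bot _)) (Or.inr (EReal.coe_ne_top _))
  obtain ⟨r, hr, hout⟩ : ∃ r ≥ 0, x₀ ∈ Metric.closedBall z r ∧
      ∀ y, R y ≠ ⊤ → r < ‖y - z‖ → (R x₀).toReal + q x₀ ≤ (R y).toReal + q y := by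
    set A := ‖v‖ + ‖x₀ - z‖ + 1
    set B := |q x₀| + A
    -- Beyond this radius the quadratic `q` exceeds `(‖v‖ + B + ‖v‖‖x₀ - z‖) ‖y - z‖`, which pays
    -- for the affine minorant of `R` and for `q x₀ ≤ B`. The final `1` ensures `‖y - z‖ ≥ 1`.
    refine ⟨‖x₀ - z‖ + 2 * γ * (‖v‖ + B + ‖v‖ * ‖x₀ - z‖) + 1, by positivity, ?_, ?_⟩
    · rw [mem_closedBall_iff_norm]
      have : 0 ≤ 2 * γ * (‖v‖ + B + ‖v‖ * ‖x₀ - z‖) := by positivity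
      linarith
    · intro y hy hlt
      have h1 := subdiff_real hR hv hx₀ hy
      have h2 : -(‖v‖ * ‖y - x₀‖) ≤ inner ℝ v (y - x₀) :=
        neg_le_of_abs_le (abs_real_inner_le_norm _ _)
      have h3 : ‖y - x₀‖ ≤ ‖y - z‖ + ‖x₀ - z‖ := by
        rw [← norm_neg (x₀ - z), neg_sub]
        simpa using norm_add_le (y - z) (z - x₀)
      have h4 : ‖v‖ * ‖y - x₀‖ ≤ ‖v‖ * (‖y - z‖ + ‖x₀ - z‖) :=
        mul_le_mul_of_nonneg_left h3 (norm_nonneg _)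
      have hs1 : 1 ≤ ‖y - z‖ := by
        have : 0 ≤ ‖x₀ - z‖ + 2 * γ * (‖v‖ + B + ‖v‖ * ‖x₀ - z‖) := by positivity
        linarith
      have h5 : 2 * γ * (‖v‖ + B + ‖v‖ * ‖x₀ - z‖) ≤ ‖y - z‖ := by
        linarith [norm_nonneg (x₀ - z)]
      have h6 : (‖v‖ + B + ‖v‖ * ‖x₀ - z‖) * ‖y - z‖ ≤ q y := by
        have : q y = (2 * γ)⁻¹ * ‖y - z‖ * ‖y - z‖ := by simp only [hq]; field_simp
        rw [this]
        refine mul_le_mul_of_nonneg_right ?_ (norm_nonneg _)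
        rw [inv_mul_eq_div, le_div_iff₀ (by positivity)]
        linarith
      have h7 : B + ‖v‖ * ‖x₀ - z‖ ≤ (B + ‖v‖ * ‖x₀ - z‖) * ‖y - z‖ :=
        le_mul_of_one_le_right (by positivity) hs1
      have h8 : q x₀ ≤ B := (le_abs_self _).trans (le_add_of_nonneg_right (by positivity))
      nlinarith
  obtain ⟨hin, hout⟩ := hout
  obtain ⟨x, hxm, hx⟩ := LowerSemicontinuousOn.exists_isMinOn ⟨x₀, hin⟩
    (isCompact_closedBall z r) (hlsc.lowerSemicontinuousOn _)
  have hxt : R x ≠ ⊤ := by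
    intro h
    have h1 := hx hin
    simp only [Set.mem_ofPred_eq, h, EReal.top_add_coe, top_le_iff] at h1
    rw [← hR.coe_toReal hx₀, ← EReal.coe_add] at h1
    exact EReal.coe_ne_top _ h1
  have hreal : ∀ y ∈ Metric.closedBall z r, R y ≠ ⊤ →
      (R x).toReal + q x ≤ (R y).toReal + q y := by
    intro y hym hy
    have h1 := hx hym
    simp only [Set.mem_ofPred_eq] at h1
    rw [← hR.coe_toReal hxt, ← hR.coe_toReal hy, ← EReal.coe_add, ← EReal.coe_add] at h1
    exact_mod_cast h1
  refine ⟨x, isProx_of_real hR hγ hxt fun y hy => ?_⟩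
  have key : (R x).toReal + q x ≤ (R y).toReal + q y := by
    by_cases hym : y ∈ Metric.closedBall z r
    · exact hreal y hym hy
    · rw [mem_closedBall_iff_norm, not_le] at hym
      exact (hreal x₀ hin hx₀).trans (hout y hy hym)
  have h3 := mul_le_mul_of_nonneg_left key hγ.le
  simp only [hq] at h3
  rwa [mul_add, mul_add, mul_inv_cancel_left₀ hγ.ne', mul_inv_cancel_left₀ hγ.ne'] at h3

end ConvexAnalysis

/-! ### Finite sums and the inexact proximal gradient step. -/

section Smooth

variable {E : Type*} [NormedAddCommGroup E] [InnerProductSpace ℝ E]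

lemma ConvexOn.add_inner_gradient_le [CompleteSpace E] {F : E → ℝ} (hF : ConvexOn ℝ Set.univ F)
    {g x : E} (hg : HasGradientAt F g x) (y : E) : F x + inner ℝ g (y - x) ≤ F y := by
  have hc : ConvexOn ℝ Set.univ (F ∘ AffineMap.lineMap (k := ℝ) x y) :=
    hF.comp_affineMap (AffineMap.lineMap (k := ℝ) x y)
  have hd : HasDerivAt (F ∘ AffineMap.lineMap (k := ℝ) x y) (inner ℝ g (y - x)) 0 := by
    have h2 : HasFDerivAt F (InnerProductSpace.toDual ℝ E g) (AffineMap.lineMap (k := ℝ) x y 0) := by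
      simpa using hg.hasFDerivAt
    simpa using h2.comp_hasDerivAt (0 : ℝ) AffineMap.hasDerivAt_lineMap
  have h := hc.le_slope_of_hasDerivAt (Set.mem_univ 0) (Set.mem_univ 1) zero_lt_one hd
  simp [slope_def_field] at h
  linarith

/-- The excess `Φ(y) - Φ(xs)` of the objective `Φ = R + F`, as a real number. -/
def gap (R : E → EReal) (F : E → ℝ) (xs y : E) : ℝ :=
  (R y).toReal + F y - ((R xs).toReal + F xs)

variable {m : ℕ} {f : Fin m → E → ℝ}

lemma convexOn_avg (hf : ∀ i, ConvexOn ℝ Set.univ (f i)) : ConvexOn ℝ Set.univ (avg f) := by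
  have h : ConvexOn ℝ Set.univ (fun x => ∑ i, f i x) := by
    refine ⟨convex_univ, fun x _ y _ a b ha hb hab => ?_⟩
    simp only [smul_eq_mul, Finset.mul_sum, ← Finset.sum_add_distrib]
    exact Finset.sum_le_sum fun i _ => (hf i).2 trivial trivial ha hb hab
  exact h.smul (by positivity : (0 : ℝ) ≤ 1 / m)

lemma hasGradientAt_avg [CompleteSpace E] (hf : ∀ i, Differentiable ℝ (f i)) (x : E) :
    HasGradientAt (avg f) ((1 / (m : ℝ)) • ∑ j, gradient (f j) x) x := by
  rw [hasGradientAt_iff_hasFDerivAt]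
  have h1 : HasFDerivAt (fun y => ∑ i, f i y)
      (∑ i, InnerProductSpace.toDual ℝ E (gradient (f i) x)) x :=
    HasFDerivAt.fun_sum fun i _ => (hf i x).hasGradientAt.hasFDerivAt
  have h2 := h1.const_mul (1 / (m : ℝ))
  refine h2.congr_fderiv ?_
  rw [map_smul, map_sum]

lemma gradient_avg [CompleteSpace E] (hf : ∀ i, Differentiable ℝ (f i)) (x : E) :
    gradient (avg f) x = (1 / (m : ℝ)) • ∑ j, gradient (f j) x :=
  (hasGradientAt_avg hf x).gradient

lemma norm_average_le [NeZero m] {v : Fin m → E} {C : ℝ} (h : ∀ j, ‖v j‖ ≤ C) :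
    ‖(1 / (m : ℝ)) • ∑ j, v j‖ ≤ C := by
  have hm : (0 : ℝ) < m := by exact_mod_cast Nat.pos_of_ne_zero (NeZero.ne m)
  rw [norm_smul, Real.norm_of_nonneg (by positivity), one_div, inv_mul_le_iff₀ hm]
  calc ‖∑ j, v j‖ ≤ ∑ j, ‖v j‖ := norm_sum_le _ _
    _ ≤ ∑ _j : Fin m, C := Finset.sum_le_sum fun j _ => h j
    _ = m * C := by simp

/-- The sum of squared deviations from the mean is at most the sum of squares. -/
lemma sum_norm_sub_mean_sq_le [NeZero m] (v : Fin m → E) :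
    ∑ j, ‖v j - (1 / (m : ℝ)) • ∑ k, v k‖ ^ 2 ≤ ∑ j, ‖v j‖ ^ 2 := by
  have hm : (m : ℝ) ≠ 0 := by exact_mod_cast NeZero.ne m
  set a := (1 / (m : ℝ)) • ∑ k, v k with ha
  have hs : ∑ k, v k = (m : ℝ) • a := by rw [ha, smul_smul, mul_one_div_cancel hm, one_smul]
  have e : ∑ j, ‖v j - a‖ ^ 2 = ∑ j, ‖v j‖ ^ 2 - m * ‖a‖ ^ 2 := by
    have : ∀ j, ‖v j - a‖ ^ 2 = ‖v j‖ ^ 2 - 2 * inner ℝ (v j) a + ‖a‖ ^ 2 := fun j =>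
      norm_sub_sq_real _ _
    simp only [this, Finset.sum_add_distrib, Finset.sum_sub_distrib, ← Finset.mul_sum,
      ← sum_inner, hs, inner_smul_left, real_inner_self_eq_norm_sq]
    simp
    ring
  rw [e]
  have : 0 ≤ (m : ℝ) * ‖a‖ ^ 2 := by positivity
  linarith

variable {R : E → EReal} {γ L : ℝ} {F : E → ℝ} {F' : E → E}

/-- The gradient inequality based at `y` replaces the usual integration along the segment; the price
is the constant `L` instead of `L/2`. -/
lemma descent_of_lipschitz (hF : ∀ x y, F x + inner ℝ (F' x) (y - x) ≤ F y)
    (hL : ∀ x y, ‖F' x - F' y‖ ≤ L * ‖x - y‖) (x y : E) :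
    F y ≤ F x + inner ℝ (F' x) (y - x) + L * ‖y - x‖ ^ 2 := by
  have h1 := hF y x
  have h2 : inner ℝ (F' y - F' x) (y - x) ≤ L * ‖y - x‖ ^ 2 :=
    (real_inner_le_norm _ _).trans (by
      have := mul_le_mul_of_nonneg_right (hL y x) (norm_nonneg (y - x))
      nlinarith)
  rw [← neg_sub y x, inner_neg_right] at h1
  rw [inner_sub_left] at h2
  linarith

/-- One inexact proximal gradient step, with moduli `α` of `R` and `β` of `F`. -/
lemma prox_step (hγ : 0 < γ)
    (hF : ∀ x y, F x + inner ℝ (F' x) (y - x) ≤ F y)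
    (hL : ∀ x y, ‖F' x - F' y‖ ≤ L * ‖x - y‖) {x g x' xs : E} {α β : ℝ}
    (hα : (R x').toReal + inner ℝ (γ⁻¹ • (x - γ • g - x')) (xs - x') + α / 2 * ‖xs - x'‖ ^ 2
      ≤ (R xs).toReal)
    (hβ : F x + inner ℝ (F' x) (xs - x) + β / 2 * ‖xs - x‖ ^ 2 ≤ F xs) :
    (1 + γ * α) * ‖x' - xs‖ ^ 2 + 2 * γ * gap R F xs x' + (1 - 2 * γ * L) * ‖x' - x‖ ^ 2
      ≤ (1 - γ * β) * ‖x - xs‖ ^ 2 - 2 * γ * inner ℝ (g - F' x) (x' - xs) := by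
  have hd := descent_of_lipschitz hF hL x x'
  -- In the variables `w = x - xs` and `d = x' - x` the claim becomes a linear combination of `hα`,
  -- `hβ` and the descent inequality, each multiplied by `2γ`.
  obtain ⟨d, rfl⟩ : ∃ d, x' = x + d := ⟨x' - x, by abel⟩
  obtain ⟨w, rfl⟩ : ∃ w, x = xs + w := ⟨x - xs, by abel⟩
  have e1 : xs - (xs + w + d) = -(w + d) := by abel
  have e2 : xs + w - γ • g - (xs + w + d) = -d - γ • g := by abel
  have e3 : xs - (xs + w) = - w := by abel
  have e4 : xs + w + d - (xs + w) = d := by abel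
  have e5 : xs + w + d - xs = w + d := by abel
  have e6 : xs + w - xs = w := by abel
  rw [e1, e2, norm_neg, inner_neg_right, inner_smul_left, inner_sub_left, inner_neg_left,
    inner_smul_left, inner_add_right, inner_add_right, real_inner_self_eq_norm_sq,
    norm_add_sq_real] at hα
  rw [e3, norm_neg, inner_neg_right] at hβ
  rw [e4] at hd
  rw [e5, e4, e6, norm_add_sq_real, inner_sub_left, inner_add_right, inner_add_right]
  simp only [conj_trivial] at hα
  rw [real_inner_comm w d] at *
  unfold gap
  have h3 := mul_le_mul_of_nonneg_left hα (by positivity : 0 ≤ 2 * γ)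
  have e7 : 2 * γ * ((R (xs + w + d)).toReal + -(γ⁻¹ * (-(inner ℝ w d + ‖d‖ ^ 2)
      - γ * (inner ℝ g w + inner ℝ g d))) + α / 2 * (‖w‖ ^ 2 + 2 * inner ℝ w d + ‖d‖ ^ 2))
      = 2 * γ * (R (xs + w + d)).toReal + 2 * (inner ℝ w d + ‖d‖ ^ 2)
        + 2 * γ * (inner ℝ g w + inner ℝ g d)
        + γ * α * (‖w‖ ^ 2 + 2 * inner ℝ w d + ‖d‖ ^ 2) := by
    field_simp
    ring
  rw [e7] at h3
  nlinarith [mul_le_mul_of_nonneg_left hβ (by positivity : 0 ≤ 2 * γ),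
    mul_le_mul_of_nonneg_left hd (by positivity : 0 ≤ 2 * γ)]

/-- The variance reduced proximal gradient step, averaged over the sampled index. -/
lemma sum_prox_step_le [CompleteSpace E] [NeZero m] (hR : IsProperConvexLsc R) (hγ : 0 < γ)
    (hF : ∀ x y, F x + inner ℝ (F' x) (y - x) ≤ F y)
    (hL : ∀ x y, ‖F' x - F' y‖ ≤ L * ‖x - y‖)
    {φ : Fin m → E → E} (hφ : ∀ j x y, ‖φ j x - φ j y‖ ≤ L * ‖x - y‖)
    (hF' : ∀ x, F' x = (1 / (m : ℝ)) • ∑ j, φ j x) {xs : E} (hxs : R xs ≠ ⊤)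
    (hex : ∀ z, ∃ x, IsProx R γ z x) {x a : E} {y : Fin m → E}
    (hy : ∀ j, IsProx R γ (x - γ • (φ j x - φ j a + F' a)) (y j)) :
    (1 / (m : ℝ)) * ∑ j, (‖y j - xs‖ ^ 2 + 2 * γ * gap R F xs (y j)
        + (1 - 2 * γ * L) * ‖y j - x‖ ^ 2)
      ≤ ‖x - xs‖ ^ 2 + 2 * γ ^ 2 * L ^ 2 * ‖x - a‖ ^ 2 := by
  have hm : (0 : ℝ) < m := by exact_mod_cast Nat.pos_of_ne_zero (NeZero.ne m)
  -- The exact step `yb` does not depend on the sampled index, so the errors `e j`, whose sum is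
  -- zero, average out against `yb - xs`. Only the pairing with `y j - yb` survives.
  obtain ⟨yb, hyb⟩ := hex (x - γ • F' x)
  set v : Fin m → E := fun j => φ j x - φ j a
  have hmean : (1 / (m : ℝ)) • ∑ k, v k = F' x - F' a := by
    simp only [v, Finset.sum_sub_distrib, smul_sub, ← hF']
  set e : Fin m → E := fun j => v j - (1 / (m : ℝ)) • ∑ k, v k
  have he : ∀ j, φ j x - φ j a + F' a - F' x = e j := fun j => by
    simp only [e, hmean, v]; abel
  have hesum : ∑ j, e j = 0 := by
    simp only [e, Finset.sum_sub_distrib, Finset.sum_const, Finset.card_univ, Fintype.card_fin]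
    rw [← Nat.cast_smul_eq_nsmul ℝ, smul_smul, mul_one_div_cancel hm.ne', one_smul, sub_self]
  have hvar : ∑ j, ‖e j‖ ^ 2 ≤ m * (L ^ 2 * ‖x - a‖ ^ 2) := by
    refine (sum_norm_sub_mean_sq_le v).trans ?_
    calc ∑ j, ‖v j‖ ^ 2 ≤ ∑ _j : Fin m, (L * ‖x - a‖) ^ 2 :=
          Finset.sum_le_sum fun j _ => pow_le_pow_left₀ (norm_nonneg _) (hφ j x a) 2
      _ = m * (L ^ 2 * ‖x - a‖ ^ 2) := by
        rw [Finset.sum_const, Finset.card_univ, Fintype.card_fin, nsmul_eq_mul, mul_pow]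
  -- Nonexpansiveness of the proximal map gives `‖y j - yb‖ ≤ γ ‖e j‖`.
  have hin : ∀ j, -(2 * γ * inner ℝ (e j) (y j - yb)) ≤ 2 * γ ^ 2 * ‖e j‖ ^ 2 := by
    intro j
    have h1 := (hy j).norm_sub_le hR hγ hyb
    rw [show x - γ • (φ j x - φ j a + F' a) - (x - γ • F' x) = -(γ • e j) by
      rw [← he]; module, norm_neg, norm_smul, Real.norm_of_nonneg hγ.le] at h1
    have h2 : -inner ℝ (e j) (y j - yb) ≤ ‖e j‖ * ‖y j - yb‖ :=
      (neg_le_abs _).trans (abs_real_inner_le_norm _ _)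
    have h3 := mul_le_mul_of_nonneg_left h1 (norm_nonneg (e j))
    have h4 : -inner ℝ (e j) (y j - yb) ≤ γ * ‖e j‖ ^ 2 := by linarith
    nlinarith
  have hstep : ∀ j, ‖y j - xs‖ ^ 2 + 2 * γ * gap R F xs (y j)
        + (1 - 2 * γ * L) * ‖y j - x‖ ^ 2
      ≤ ‖x - xs‖ ^ 2 + 2 * γ ^ 2 * ‖e j‖ ^ 2 - 2 * γ * inner ℝ (e j) (yb - xs) := by
    intro j
    have hα : (R (y j)).toReal + inner ℝ
        (γ⁻¹ • (x - γ • (φ j x - φ j a + F' a) - y j)) (xs - y j)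
        + 0 / 2 * ‖xs - y j‖ ^ 2 ≤ (R xs).toReal := by
      simpa using subdiff_real hR ((hy j).mem_subdiff hR hγ) ((hy j).ne_top hR hγ) hxs
    have h := prox_step (α := 0) (β := 0) hγ hF hL hα (by simpa using hF x xs)
    rw [he] at h
    have h2 : inner ℝ (e j) (y j - xs) = inner ℝ (e j) (y j - yb) + inner ℝ (e j) (yb - xs) := by
      rw [← inner_add_right]; congr 1; abel
    rw [h2] at h
    linarith [hin j]
  have hsum : ∑ j, (‖x - xs‖ ^ 2 + 2 * γ ^ 2 * ‖e j‖ ^ 2 - 2 * γ * inner ℝ (e j) (yb - xs))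
      = m * ‖x - xs‖ ^ 2 + 2 * γ ^ 2 * ∑ j, ‖e j‖ ^ 2 := by
    rw [Finset.sum_sub_distrib, Finset.sum_add_distrib, ← Finset.mul_sum, ← Finset.mul_sum,
      ← sum_inner, hesum]
    simp
  rw [one_div, inv_mul_le_iff₀ hm]
  refine (Finset.sum_le_sum fun j _ => hstep j).trans ?_
  rw [hsum]
  nlinarith [mul_le_mul_of_nonneg_left hvar (by positivity : 0 ≤ 2 * γ ^ 2)]

end Smooth

/-! ### The Hessian: symmetry, positivity and Taylor bounds. -/

section SecondOrder

variable {E : Type*} [NormedAddCommGroup E] [InnerProductSpace ℝ E] [CompleteSpace E]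
  {F : E → ℝ} {xs : E}

/-- The inverse of the Riesz isomorphism as a real-linear continuous map. -/
noncomputable def rieszSymm (E : Type*) [NormedAddCommGroup E] [InnerProductSpace ℝ E]
    [CompleteSpace E] : StrongDual ℝ E →L[ℝ] E :=
  LinearMap.mkContinuous
    { toFun := (InnerProductSpace.toDual ℝ E).symm
      map_add' := fun a b => map_add _ a b
      map_smul' := fun c a => by simp } 1 fun a => by simp

lemma contDiffAt_gradient (hF : ContDiffAt ℝ 2 F xs) : ContDiffAt ℝ 1 (gradient F) xs :=
  (rieszSymm E).contDiff.contDiffAt.comp xs (hF.fderiv_right (m := 1) (by norm_num))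

lemma hasStrictFDerivAt_gradient (hF : ContDiffAt ℝ 2 F xs) :
    HasStrictFDerivAt (gradient F) (hessian F xs) xs :=
  (contDiffAt_gradient hF).hasStrictFDerivAt (by norm_num)

lemma continuousAt_hessian (hF : ContDiffAt ℝ 2 F xs) : ContinuousAt (hessian F) xs :=
  ((contDiffAt_gradient hF).fderiv_right (m := 0) (by norm_num)).continuousAt

/-- Under the Riesz isomorphism the Hessian is the second derivative, which is symmetric for a `C²`
function. -/
lemma inner_hessian_symm (hF : ContDiffAt ℝ 2 F xs) (v w : E) :
    inner ℝ (hessian F xs v) w = inner ℝ v (hessian F xs w) := by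
  have hd : DifferentiableAt ℝ (fderiv ℝ F) xs :=
    (hF.fderiv_right (m := 1) (by norm_num)).differentiableAt (by norm_num)
  have e : hessian F xs = (rieszSymm E).comp (fderiv ℝ (fderiv ℝ F) xs) :=
    ((rieszSymm E).hasFDerivAt.comp xs hd.hasFDerivAt).fderiv
  have key : ∀ a b, inner ℝ (hessian F xs a) b = fderiv ℝ (fderiv ℝ F) xs a b := by
    intro a b
    rw [e]
    exact InnerProductSpace.toDual_symm_apply
  rw [key, real_inner_comm, key]
  exact hF.isSymmSndFDerivAt (by simp) v w

/-- Adding two gradient inequalities shows that the gradient is monotone along the line, so the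
difference quotients of `⟪h, ∇F(xs + t h)⟫` at `0` are nonnegative. -/
lemma inner_hessian_nonneg (hF : ContDiffAt ℝ 2 F xs)
    (hc : ∀ x y, F x + inner ℝ (gradient F x) (y - x) ≤ F y) (h : E) :
    0 ≤ inner ℝ h (hessian F xs h) := by
  have hd : HasDerivAt (fun t : ℝ => inner ℝ h (gradient F (xs + t • h)))
      (inner ℝ h (hessian F xs h)) 0 := by
    have h1 : HasDerivAt (fun t : ℝ => xs + t • h) h 0 := by
      simpa using ((hasDerivAt_id (0 : ℝ)).smul_const h).const_add xs
    have h2 : HasFDerivAt (gradient F) (hessian F xs) (xs + (0 : ℝ) • h) := by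
      simpa using (hasStrictFDerivAt_gradient hF).hasFDerivAt
    have h3 := h2.comp_hasDerivAt (0 : ℝ) h1
    simpa [Function.comp_def] using (innerSL ℝ h).hasFDerivAt.comp_hasDerivAt (0 : ℝ) h3
  refine ge_of_tendsto hd.tendsto_slope_zero_right ?_
  filter_upwards [self_mem_nhdsWithin] with t (ht : 0 < t)
  have h1 := hc xs (xs + t • h)
  have h2 := hc (xs + t • h) xs
  rw [add_sub_cancel_left, inner_smul_right] at h1
  rw [sub_add_cancel_left, inner_neg_right, inner_smul_right] at h2
  simp only [zero_add, zero_smul, add_zero, smul_eq_mul]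
  rw [real_inner_comm, real_inner_comm _ h]
  refine mul_nonneg (inv_nonneg.2 ht.le) ?_
  refine nonneg_of_mul_nonneg_right (b := _) (a := t) ?_ ht
  rw [mul_sub]
  linarith

/-- A function whose gradient is `ε`-Lipschitz along the segment is first order Taylor expanded
up to `ε ‖y - x‖²`. -/
lemma abs_taylor_le {q : E → ℝ} {q' : E → E} {ε : ℝ} {x y : E}
    (hq : ∀ z ∈ segment ℝ x y, HasGradientAt q (q' z) z) (hε : 0 ≤ ε)
    (hl : ∀ z ∈ segment ℝ x y, ‖q' z - q' x‖ ≤ ε * ‖z - x‖) :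
    |q y - q x - inner ℝ (q' x) (y - x)| ≤ ε * ‖y - x‖ ^ 2 := by
  have h := Convex.norm_image_sub_le_of_norm_hasFDerivWithin_le' (𝕜 := ℝ) (f := q)
    (f' := fun z => InnerProductSpace.toDual ℝ E (q' z)) (φ := InnerProductSpace.toDual ℝ E (q' x))
    (C := ε * ‖y - x‖) (s := segment ℝ x y)
    (fun z hz => (hq z hz).hasFDerivAt.hasFDerivWithinAt) (fun z hz => by
      rw [← map_sub, LinearIsometryEquiv.norm_map]
      exact (hl z hz).trans (mul_le_mul_of_nonneg_left (norm_sub_le_of_mem_segment hz) hε))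
    (convex_segment x y) (left_mem_segment ℝ x y) (right_mem_segment ℝ x y)
  rw [InnerProductSpace.toDual_apply_apply, Real.norm_eq_abs] at h
  nlinarith

/-- Strict differentiability of the gradient at `xs` makes the gradient of `F` minus its quadratic
model `ε`-Lipschitz near `xs`. The expansion can therefore be based at `xs` or at `x`, with the
Hessian frozen at `xs` in both cases. -/
lemma exists_taylor_ball (hd : Differentiable ℝ F) (hF : ContDiffAt ℝ 2 F xs) {ε : ℝ}
    (hε : 0 < ε) : ∃ r > 0, ∀ x, ‖x - xs‖ ≤ r →
      F xs + inner ℝ (gradient F xs) (x - xs) + inner ℝ (x - xs) (hessian F xs (x - xs)) / 2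
        - ε * ‖x - xs‖ ^ 2 ≤ F x ∧
      F x + inner ℝ (gradient F x) (xs - x) + inner ℝ (x - xs) (hessian F xs (x - xs)) / 2
        - ε * ‖x - xs‖ ^ 2 ≤ F xs := by
  set H := hessian F xs
  obtain ⟨s, hs, hap⟩ := (hasStrictFDerivAt_gradient hF).approximates_deriv_on_nhds
    (c := ⟨ε, hε.le⟩) (Or.inr hε)
  obtain ⟨r, hr, hrs⟩ := Metric.nhds_basis_closedBall.mem_iff.1 hs
  set q : E → ℝ := fun x => F x - inner ℝ (x - xs) (H (x - xs)) / 2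
  set q' : E → E := fun x => gradient F x - H (x - xs)
  have hq : ∀ z, HasGradientAt q (q' z) z := by
    intro z
    rw [hasGradientAt_iff_hasFDerivAt]
    have h1 : HasFDerivAt (fun y : E => y - xs) (ContinuousLinearMap.id ℝ E) z :=
      (hasFDerivAt_id z).sub_const xs
    have h2 := (h1.inner ℝ (H.hasFDerivAt.comp z h1)).const_mul (1 / 2 : ℝ)
    have h3 := (hd z).hasGradientAt.hasFDerivAt.sub h2
    refine (h3.congr_fderiv ?_).congr_of_eventuallyEq (Eventually.of_forall fun y => ?_)
    · ext v
      have := inner_hessian_symm hF (z - xs) v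
      have h5 := real_inner_comm v (H (z - xs))
      simp [q', inner_sub_left, fderivInnerCLM_apply, H] at this h5 ⊢
      linarith
    · simp only [q, Function.comp_apply, Pi.sub_apply]; ring
  have hlip : ∀ x y, ‖x - xs‖ ≤ r → ‖y - xs‖ ≤ r → ‖q' x - q' y‖ ≤ ε * ‖x - y‖ := by
    intro x y hx hy
    have h := hap x (hrs (mem_closedBall_iff_norm.2 hx)) y (hrs (mem_closedBall_iff_norm.2 hy))
    have e : q' x - q' y = gradient F x - gradient F y - H (x - y) := by
      simp only [q', map_sub]; abel
    rw [e]
    exact h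
  have hball : ∀ x z, ‖x - xs‖ ≤ r → z ∈ segment ℝ xs x → ‖z - xs‖ ≤ r := fun x z hx hz =>
    (norm_sub_le_of_mem_segment hz).trans hx
  refine ⟨r, hr, fun x hx => ⟨?_, ?_⟩⟩
  · have h := (abs_le.1 (abs_taylor_le (x := xs) (y := x) (fun z _ => hq z) hε.le fun z hz =>
      hlip z xs (hball x z hx hz) (by simpa using hr.le))).1
    simp only [q, q', sub_self, map_zero, inner_zero_left] at h
    simp only [sub_zero, zero_div] at h
    linarith
  · have h := (abs_le.1 (abs_taylor_le (x := x) (y := xs) (fun z _ => hq z) hε.le fun z hz =>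
      hlip z x (hball x z hx (by rwa [segment_symm])) hx)).1
    simp only [q, q', sub_self, map_zero, inner_zero_left] at h
    have h1 : inner ℝ (H (x - xs)) (x - xs) = inner ℝ (x - xs) (H (x - xs)) :=
      real_inner_comm _ _
    rw [norm_sub_rev xs x, ← neg_sub x xs, inner_neg_right, inner_sub_left (gradient F x), h1] at h
    simp only [zero_div] at h
    rw [← neg_sub x xs, inner_neg_right]
    linarith

/-- Restricted injectivity turns into a uniform positive curvature on `T` near `xs`. -/
lemma exists_isRestrictedModulus [FiniteDimensional ℝ E] {T : Submodule ℝ E}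
    (hc : ∀ x y, F x + inner ℝ (gradient F x) (y - x) ≤ F y)
    (hRI : RestrictedInjectivity F T xs) : ∃ α > 0, IsRestrictedModulus F T xs α := by
  obtain ⟨hF, hker⟩ := hRI
  set H := hessian F xs with hH
  have hpos : ∀ h ∈ T, h ≠ 0 → 0 < inner ℝ h (H h) := by
    intro h hT h0
    refine (inner_hessian_nonneg hF hc h).lt_of_ne fun heq => h0 ?_
    -- A positive semidefinite form that vanishes at `h` has `h` in its kernel: otherwise it would
    -- be negative at some `h + t • w`.
    have hz : ∀ w, inner ℝ (H h) w = 0 := by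
      intro w
      by_contra hne
      set b := inner ℝ (H h) w with hb
      have hq : ∀ t : ℝ, 0 ≤ 2 * t * b + t ^ 2 * inner ℝ w (H w) := by
        intro t
        have h1 := inner_hessian_nonneg hF hc (h + t • w)
        rw [← hH, map_add, map_smul, inner_add_left, inner_add_right, inner_add_right,
          ← heq, inner_smul_right, inner_smul_left, inner_smul_left, inner_smul_right,
          ← inner_hessian_symm hF h w, ← hH, ← hb, real_inner_comm (H h) w, ← hb] at h1
        simp only [conj_trivial] at h1
        linarith
      set c := inner ℝ w (H w)
      have hc0 : 0 ≤ c := inner_hessian_nonneg hF hc w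
      -- Nearly the minimiser `-b / c` of the quadratic; the `1` covers `c = 0`.
      have h2 := hq (-b / (c + 1))
      have h3 : 2 * (-b / (c + 1)) * b + (-b / (c + 1)) ^ 2 * c
          = - (b ^ 2 * (c + 2)) / (c + 1) ^ 2 := by
        field_simp
        ring
      rw [h3] at h2
      have : 0 < b ^ 2 * (c + 2) / (c + 1) ^ 2 := by positivity
      rw [neg_div] at h2
      linarith
    have hHh : H h = 0 := by
      have := hz (H h)
      rwa [real_inner_self_eq_norm_sq, sq_eq_zero_iff, norm_eq_zero] at this
    have : h ∈ (H : E →ₗ[ℝ] E).ker ⊓ T := ⟨hHh, hT⟩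
    rw [hker] at this
    exact this
  have : ProperSpace E := FiniteDimensional.proper ℝ E
  have hcpt : IsCompact (Metric.sphere (0 : E) 1 ∩ T) :=
    (isCompact_sphere 0 1).inter_right T.closed_of_finiteDimensional
  obtain ⟨α, hα, hαs⟩ : ∃ α > 0, ∀ h ∈ Metric.sphere (0 : E) 1 ∩ T, α ≤ inner ℝ h (H h) := by
    -- The intersection is empty exactly when `T` is trivial; any positive `α` then serves.
    rcases (Metric.sphere (0 : E) 1 ∩ (T : Set E)).eq_empty_or_nonempty with he | hne
    · exact ⟨1, one_pos, by simp [he]⟩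
    · obtain ⟨h0, hm, hmin⟩ := hcpt.exists_isMinOn hne
        (f := fun h => inner ℝ h (H h)) (by fun_prop)
      refine ⟨_, hpos h0 hm.2 ?_, fun h hh => hmin hh⟩
      rintro rfl
      simpa using hm.1
  have hnear : ∀ᶠ x in 𝓝 xs, ‖hessian F x - H‖ < α / 2 := by
    have h1 := (continuousAt_hessian hF).sub_const H |>.norm
    have h2 : ‖hessian F xs - H‖ < α / 2 := by simpa [hH] using hα
    exact h1.eventually_lt_const h2
  obtain ⟨r, hr, hrs⟩ := Metric.nhds_basis_closedBall.mem_iff.1 hnear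
  refine ⟨α / 2, by positivity, r, hr, fun x hx h hT => ?_⟩
  have h1 : α * ‖h‖ ^ 2 ≤ inner ℝ h (H h) := by
    by_cases h0 : h = 0
    · simp [h0]
    have hn : ‖h‖ ≠ 0 := norm_ne_zero_iff.2 h0
    have := hαs (‖h‖⁻¹ • h) ⟨by simp [norm_smul, hn], T.smul_mem _ hT⟩
    rw [map_smul, inner_smul_left, inner_smul_right] at this
    simp only [conj_trivial] at this
    calc α * ‖h‖ ^ 2 ≤ ‖h‖⁻¹ * (‖h‖⁻¹ * inner ℝ h (H h)) * ‖h‖ ^ 2 :=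
          mul_le_mul_of_nonneg_right this (by positivity)
      _ = inner ℝ h (H h) := by field_simp
  have h2 : -(α / 2 * ‖h‖ ^ 2) ≤ inner ℝ h ((hessian F x - H) h) := by
    refine neg_le_of_abs_le ((abs_real_inner_le_norm _ _).trans ?_)
    have h3 := (hessian F x - H).le_opNorm h
    have h4 : ‖hessian F x - H‖ ≤ α / 2 := (hrs (mem_closedBall_iff_norm.2 hx)).le
    nlinarith [norm_nonneg h, mul_le_mul_of_nonneg_right h4 (norm_nonneg h)]
  rw [sub_apply, inner_sub_right] at h2
  linarith

end SecondOrder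

/-! ### Quadratic growth of the objective at a nondegenerate minimiser. -/

section Growth

variable {E : Type*} [NormedAddCommGroup E] [InnerProductSpace ℝ E]
  {R : E → EReal} {F : E → ℝ} {xs : E}

/-- Nondegeneracy: a relative neighbourhood of a relative interior point. -/
lemma exists_ball_of_mem_intrinsicInterior {s : Set E} {v : E} (hv : v ∈ intrinsicInterior ℝ s) :
    ∃ δ > 0, ∀ u ∈ vectorSpan ℝ s, ‖u‖ ≤ δ → v + u ∈ s := by
  obtain ⟨y, hy, rfl⟩ := mem_intrinsicInterior.1 hv
  obtain ⟨δ, hδ, hs⟩ := Metric.nhds_basis_closedBall.mem_iff.1 (mem_interior_iff_mem_nhds.1 hy)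
  refine ⟨δ, hδ, fun u hu hn => ?_⟩
  have hm : (y : E) + u ∈ affineSpan ℝ s := by
    have := AffineSubspace.vadd_mem_of_mem_direction
      (by rwa [direction_affineSpan] : u ∈ (affineSpan ℝ s).direction) y.2
    rwa [vadd_eq_add, add_comm] at this
  have : (⟨y + u, hm⟩ : affineSpan ℝ s) ∈ Metric.closedBall y δ := by
    rw [Metric.mem_closedBall, Subtype.dist_eq, dist_eq_norm]
    simpa using hn
  exact hs this

/-- The Hessian form at a point with tangential part `t` and normal part `w - t`. -/
lemma inner_hessian_ge [CompleteSpace E] (hc : ∀ x y, F x + inner ℝ (gradient F x) (y - x) ≤ F y)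
    (hF : ContDiffAt ℝ 2 F xs) {α : ℝ} {t w : E}
    (ht : α * ‖t‖ ^ 2 ≤ inner ℝ t (hessian F xs t)) (htw : ‖t‖ ≤ ‖w‖) :
    α * ‖t‖ ^ 2 - 2 * (‖hessian F xs‖ * ‖w‖ * ‖w - t‖) ≤ inner ℝ w (hessian F xs w) := by
  set H := hessian F xs
  obtain ⟨n, rfl⟩ : ∃ n, w = t + n := ⟨w - t, by abel⟩
  rw [add_sub_cancel_left]
  have h2 := inner_hessian_nonneg hF hc n
  have h3 : -(‖H‖ * ‖t + n‖ * ‖n‖) ≤ inner ℝ (H t) n := by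
    refine neg_le_of_abs_le ((abs_real_inner_le_norm _ _).trans ?_)
    refine mul_le_mul_of_nonneg_right ?_ (norm_nonneg _)
    exact (H.le_opNorm t).trans (mul_le_mul_of_nonneg_left htw (norm_nonneg _))
  have h4 : inner ℝ n (H t) = inner ℝ (H t) n := real_inner_comm _ _
  have h5 : inner ℝ t (H n) = inner ℝ (H t) n := (inner_hessian_symm hF t n).symm
  rw [map_add, inner_add_left, inner_add_right, inner_add_right, h4, h5]
  linarith

/-- Quadratic growth of `Φ` near `xs`. -/
lemma exists_quadratic_growth [FiniteDimensional ℝ E] (hR : IsProperConvexLsc R)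
    (hd : Differentiable ℝ F)
    (hc : ∀ x y, F x + inner ℝ (gradient F x) (y - x) ≤ F y) (hF : ContDiffAt ℝ 2 F xs)
    {T : Submodule ℝ E} {α δ : ℝ} (hα : 0 < α) (hδ : 0 < δ)
    (hmod : ∀ h ∈ T, α * ‖h‖ ^ 2 ≤ inner ℝ h (hessian F xs h))
    (hball : ∀ u ∈ Tᗮ, ‖u‖ ≤ δ → -gradient F xs + u ∈ subdiff R xs) :
    ∃ c > 0, ∃ r > 0, ∀ x, ‖x - xs‖ ≤ r → R x ≠ ⊤ → c * ‖x - xs‖ ^ 2 ≤ gap R F xs x := by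
  set H := hessian F xs with hH
  obtain ⟨r, hr, hT⟩ := exists_taylor_ball hd hF (show 0 < α / 8 by positivity)
  have hxs : R xs ≠ ⊤ := ne_top_of_mem_subdiff hR (hball 0 (zero_mem _) (by simpa using hδ.le))
  -- Curvature covers the tangential part `t`, and the nondegeneracy term `δ‖n‖` covers the normal
  -- part `n`. On this radius half of `δ‖n‖` dominates both the Hessian cross term `‖H‖‖w‖‖n‖` and
  -- `α‖n‖²`. What remains is at least `α/2 ‖w‖²`, less the Taylor error `α/8 ‖w‖²`.
  refine ⟨3 * α / 8, by positivity, min r (δ / (2 * (‖H‖ + α + 1))),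
    lt_min hr (by positivity), fun x hx hxt => ?_⟩
  have hx2 := hx.trans (min_le_right _ _)
  have hTx := (hT x (hx.trans (min_le_left _ _))).1
  set w := x - xs with hw
  set t := T.starProjection w with ht
  set n := w - t with hn
  have htT : t ∈ T := T.starProjection_apply_mem w
  have hnT : n ∈ Tᗮ := T.sub_starProjection_mem_orthogonal w
  have hwtn : w = t + n := by rw [hn]; abel
  have htn : inner ℝ t n = 0 := Submodule.inner_right_of_mem_orthogonal htT hnT
  have hsq : ‖w‖ ^ 2 = ‖t‖ ^ 2 + ‖n‖ ^ 2 := by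
    rw [hwtn, norm_add_sq_real, htn]; ring
  have htw : ‖t‖ ≤ ‖w‖ := T.norm_starProjection_apply_le w
  have hnw : ‖n‖ ≤ ‖w‖ :=
    le_of_sq_le_sq (by rw [hsq]; linarith [sq_nonneg ‖t‖]) (norm_nonneg w)
  have hRx : (R xs).toReal - inner ℝ (gradient F xs) w + δ * ‖n‖ ≤ (R x).toReal := by
    by_cases hn0 : n = 0
    · have := subdiff_real hR (hball 0 (zero_mem _) (by simpa using hδ.le)) hxs hxt
      rw [add_zero, inner_neg_left] at this
      rw [hn0, norm_zero]
      linarith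
    · have hnn : ‖n‖ ≠ 0 := norm_ne_zero_iff.2 hn0
      -- Among the available subgradients, the one tilted by `δ` along `n` gives the sharpest lower
      -- bound in the direction `w`.
      have := subdiff_real hR (hball ((δ / ‖n‖) • n) (Tᗮ.smul_mem _ hnT) (by
        rw [norm_smul, Real.norm_of_nonneg (by positivity), div_mul_cancel₀ _ hnn])) hxs hxt
      rw [inner_add_left, inner_neg_left, inner_smul_left, ← hw] at this
      have e : inner ℝ n w = ‖n‖ ^ 2 := by
        rw [hwtn, inner_add_right, real_inner_comm, htn, real_inner_self_eq_norm_sq, zero_add]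
      rw [e] at this
      simp only [conj_trivial] at this
      have e2 : δ / ‖n‖ * ‖n‖ ^ 2 = δ * ‖n‖ := by field_simp
      linarith
  have hHw : α * ‖t‖ ^ 2 - 2 * (‖H‖ * ‖w‖ * ‖n‖) ≤ inner ℝ w (H w) :=
    inner_hessian_ge hc hF (hmod t htT) htw
  have hlin : (‖H‖ + α + 1) * ‖w‖ * ‖n‖ ≤ δ / 2 * ‖n‖ := by
    refine mul_le_mul_of_nonneg_right ?_ (norm_nonneg _)
    calc (‖H‖ + α + 1) * ‖w‖ ≤ (‖H‖ + α + 1) * (δ / (2 * (‖H‖ + α + 1))) :=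
          mul_le_mul_of_nonneg_left hx2 (by positivity)
      _ = δ / 2 := by field_simp
  have hnn := mul_le_mul_of_nonneg_right hnw (norm_nonneg n)
  have hwn : 0 ≤ ‖w‖ * ‖n‖ := by positivity
  have hnδ : 0 ≤ δ * ‖n‖ := by positivity
  unfold gap
  nlinarith

/-- Growth away from `xs` follows from growth on a small ball by convexity. -/
lemma gap_growth_outside (hR : IsProperConvexLsc R) (hFc : ConvexOn ℝ Set.univ F)
    (hxs : R xs ≠ ⊤) {c r : ℝ} (hr : 0 < r)
    (hg : ∀ x, ‖x - xs‖ ≤ r → R x ≠ ⊤ → c * ‖x - xs‖ ^ 2 ≤ gap R F xs x)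
    {x : E} (hx : R x ≠ ⊤) (hxr : r ≤ ‖x - xs‖) : c * r * ‖x - xs‖ ≤ gap R F xs x := by
  have hw : 0 < ‖x - xs‖ := hr.trans_le hxr
  set t := r / ‖x - xs‖ with ht
  have ht0 : 0 < t := by positivity
  have ht1 : t ≤ 1 := (div_le_one hw).2 hxr
  have e : ‖xs + t • (x - xs) - xs‖ = r := by
    rw [add_sub_cancel_left, norm_smul, Real.norm_of_nonneg ht0.le, ht, div_mul_cancel₀ _ hw.ne']
  have h1 := hg _ e.le (hR.combo_ne_top hxs hx ht0.le ht1)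
  have h2 := hR.toReal_combo_le hxs hx ht0.le ht1
  have h3 : F (xs + t • (x - xs)) ≤ F xs + t * (F x - F xs) := by
    have := hFc.2 (Set.mem_univ xs) (Set.mem_univ x) (sub_nonneg.2 ht1) ht0.le (by ring)
    rw [show (1 - t) • xs + t • x = xs + t • (x - xs) by module] at this
    simp only [smul_eq_mul] at this
    linarith
  have h4 : c * r ^ 2 ≤ t * gap R F xs x := by
    rw [e] at h1
    unfold gap at h1 ⊢
    linarith
  have h5 : t * ‖x - xs‖ = r := div_mul_cancel₀ _ hw.ne'
  have h6 : r * (c * r * ‖x - xs‖) ≤ r * gap R F xs x := by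
    calc r * (c * r * ‖x - xs‖) = c * r ^ 2 * ‖x - xs‖ := by ring
      _ ≤ t * gap R F xs x * ‖x - xs‖ := mul_le_mul_of_nonneg_right h4 hw.le
      _ = r * gap R F xs x := by rw [← h5]; ring
  exact le_of_mul_le_mul_left h6 hr

end Growth

/-! ### Finite identification of the active manifold. -/

section Identification

variable {E : Type*} [NormedAddCommGroup E] [InnerProductSpace ℝ E] [FiniteDimensional ℝ E]
  {R : E → EReal} {xs : E} {M : Set E}

lemma vectorSpan_subdiff_eq (R : E → EReal) (x : E) :
    (modelSubspace R x)ᗮ = vectorSpan ℝ (subdiff R x) :=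
  Submodule.orthogonal_orthogonal _

/-- Points of a manifold near `xs` leave `xs` tangentially. -/
lemma PartlySmooth.exists_tangent_ball (hM : PartlySmooth R xs M) {ε : ℝ} (hε : 0 < ε) :
    ∃ r > 0, ∀ x ∈ M, ‖x - xs‖ ≤ r →
      ‖(x - xs) - (modelSubspace R xs).starProjection (x - xs)‖ ≤ ε * ‖x - xs‖ := by
  obtain ⟨c, G, hG, hker⟩ := hM.manifold_sharp
  set T := modelSubspace R xs
  set A := fderiv ℝ G xs
  -- Since the kernel of `A` is `T`, the map `A` is injective on `Tᗮ`, hence bounded below there. It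
  -- thus detects the normal part of `x - xs`, on which `G` vanishes to first order.
  have hinj : ((A : E →ₗ[ℝ] EuclideanSpace ℝ (Fin c)) ∘ₗ Tᗮ.subtype).ker = ⊥ := by
    rw [LinearMap.ker_eq_bot']
    rintro ⟨u, hu⟩ h
    have h1 : u ∈ T := by rw [← hker]; exact h
    have h2 := Submodule.inner_right_of_mem_orthogonal h1 hu
    rw [inner_self_eq_zero] at h2
    exact Subtype.ext h2
  obtain ⟨K, hK, hanti⟩ := LinearMap.exists_antilipschitzWith _ hinj
  have hKn : ∀ u ∈ Tᗮ, ‖u‖ ≤ K * ‖A u‖ := by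
    intro u hu
    have := hanti.le_mul_dist ⟨u, hu⟩ 0
    simpa using this
  have hK' : (0 : ℝ) < K := hK
  have hd : HasFDerivAt G A xs := (hG.contDiffAt.differentiableAt (by norm_num)).hasFDerivAt
  have hlo := hd.isLittleO.def (show 0 < ε / K by positivity)
  obtain ⟨r, hr, hrs⟩ := Metric.nhds_basis_closedBall.mem_iff.1 (hlo.and hG.mem_iff)
  refine ⟨r, hr, fun x hx hxr => ?_⟩
  obtain ⟨h1, h2⟩ := hrs (mem_closedBall_iff_norm.2 hxr)
  have hGx : G x = 0 := h2.1 hx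
  have hGs : G xs = 0 := (hrs (Metric.mem_closedBall_self hr.le)).2.1 hM.mem
  rw [hGx, hGs, sub_zero, zero_sub, norm_neg] at h1
  set w := x - xs
  have hAt : A (T.starProjection w) = 0 := by
    have : T.starProjection w ∈ (A : E →ₗ[ℝ] EuclideanSpace ℝ (Fin c)).ker := by
      rw [hker]; exact T.starProjection_apply_mem w
    exact this
  calc ‖w - T.starProjection w‖ ≤ K * ‖A (w - T.starProjection w)‖ :=
        hKn _ (T.sub_starProjection_mem_orthogonal w)
    _ = K * ‖A w‖ := by rw [map_sub, hAt, sub_zero]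
    _ ≤ K * (ε / K * ‖w‖) := mul_le_mul_of_nonneg_left h1 hK'.le
    _ = ε * ‖w‖ := by field_simp

/-- Near `xs` every point has a point of the manifold in the direction normal to `M` at `xs`. -/
lemma PartlySmooth.eventually_exists_normal (hM : PartlySmooth R xs M) {U : Set E}
    (hU : U ∈ 𝓝 xs) :
    ∀ᶠ x in 𝓝 xs, ∃ y ∈ U, y ∈ M ∧ x - y ∈ (modelSubspace R xs)ᗮ := by
  obtain ⟨c, G, hG, hker⟩ := hM.manifold_sharp
  set T := modelSubspace R xs
  set A := fderiv ℝ G xs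
  set p : E →L[ℝ] T := T.orthogonalProjectionOnto
  have hd : HasStrictFDerivAt G A xs := hG.contDiffAt.hasStrictFDerivAt (by norm_num)
  -- The pair (defining map, projection onto `T`) has surjective derivative, hence is open at `xs`.
  -- A preimage of `(0, p x)` is a point of the manifold with the same tangential coordinate as `x`.
  have hΨ : HasStrictFDerivAt (fun x => (G x, p x)) (A.prod p) xs :=
    hd.prodMk p.hasStrictFDerivAt
  have hsurj : (A.prod p : E →ₗ[ℝ] EuclideanSpace ℝ (Fin c) × T).range = ⊤ := by
    rw [LinearMap.range_eq_top]
    rintro ⟨a, t⟩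
    obtain ⟨e, he⟩ := hG.surjective a
    have hmem : ((t - p e : T) : E) ∈ (A : E →ₗ[ℝ] EuclideanSpace ℝ (Fin c)).ker := by
      rw [hker]; exact (t - p e).2
    have hz : A ((t - p e : T) : E) = 0 := hmem
    refine ⟨e + ((t - p e : T) : E), ?_⟩
    have hp : p ((t - p e : T) : E) = t - p e :=
      T.orthogonalProjectionOnto_mem_subspace_eq_self _
    change (A (e + ((t - p e : T) : E)), p (e + ((t - p e : T) : E))) = (a, t)
    rw [map_add, map_add, hz, hp, add_zero, add_sub_cancel]
    exact Prod.ext he rfl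
  have hmap := hΨ.map_nhds_eq_of_surj hsurj
  have hGs : G xs = 0 := hG.mem_iff.self_of_nhds.1 hM.mem
  have himg : (fun x => (G x, p x)) '' (U ∩ {y | y ∈ M ↔ G y = 0}) ∈ 𝓝 (G xs, p xs) := by
    rw [← hmap]
    exact image_mem_map (inter_mem hU hG.mem_iff)
  have hcont : Tendsto (fun x => ((0 : EuclideanSpace ℝ (Fin c)), p x)) (𝓝 xs)
      (𝓝 (G xs, p xs)) := by
    rw [hGs]
    exact (Continuous.prodMk continuous_const p.continuous).continuousAt
  filter_upwards [hcont himg] with x hx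
  obtain ⟨y, ⟨hyU, hyM⟩, hy⟩ := hx
  obtain ⟨h1, h2⟩ := Prod.ext_iff.1 hy
  refine ⟨y, hyU, hyM.2 h1, ?_⟩
  have h3 : T.starProjection (x - y) = 0 := by
    have : p (x - y) = 0 := by
      rw [map_sub]
      exact sub_eq_zero.2 h2.symm
    rw [Submodule.starProjection_apply]
    exact congrArg Subtype.val this
  have := T.sub_starProjection_mem_orthogonal (x - y)
  rwa [h3, sub_zero] at this

/-- Finite identification: a point near `xs` carrying a subgradient near a relative interior
subgradient at `xs` lies on the manifold. -/
lemma PartlySmooth.identification (hR : IsProperConvexLsc R) (hM : PartlySmooth R xs M) {v₀ : E}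
    {δ : ℝ} (hδ : 0 < δ)
    (hball : ∀ u ∈ (modelSubspace R xs)ᗮ, ‖u‖ ≤ δ → v₀ + u ∈ subdiff R xs) :
    ∃ r > 0, ∀ x v, ‖x - xs‖ < r → v ∈ subdiff R x → ‖v - v₀‖ < r → x ∈ M := by
  have : ProperSpace E := FiniteDimensional.proper ℝ E
  set N := (modelSubspace R xs)ᗮ with hN
  have hδ8 : 0 < δ / 8 := by positivity
  set S : Set E := Metric.sphere (0 : E) δ ∩ N
  have hcpt : IsCompact S :=
    (isCompact_sphere 0 δ).inter_right N.closed_of_finiteDimensional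
  -- Inner semicontinuity handles one subgradient at a time; a finite net of the normal sphere makes
  -- it uniform over all normal directions.
  obtain ⟨t, htS, htf, hcov⟩ := hcpt.finite_cover_balls hδ8
  have hsub : ∀ u ∈ t, ∀ᶠ y in 𝓝[M] xs, ∃ w ∈ subdiff R y, ‖w - (v₀ + u)‖ < δ / 8 := by
    intro u hu
    have := htS hu
    exact hM.inner_continuous _ (hball u this.2 (by simpa using this.1.le)) _ hδ8
  have hall : ∀ᶠ y in 𝓝[M] xs, ∀ u ∈ t, ∃ w ∈ subdiff R y, ‖w - (v₀ + u)‖ < δ / 8 :=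
    (htf.eventually_all).2 hsub
  have hU := eventually_nhdsWithin_iff.1 hall
  obtain ⟨r, hr, hrs⟩ := Metric.nhds_basis_ball.mem_iff.1 (hM.eventually_exists_normal hU)
  refine ⟨min r (δ / 8), lt_min hr hδ8, fun x v hx hv hvv => ?_⟩
  obtain ⟨y, hyU, hyM, hxy⟩ := hrs (mem_ball_iff_norm.2 (hx.trans_le (min_le_left _ _)))
  have hvv' := hvv.trans_le (min_le_right _ _)
  by_cases hne : x = y
  · rwa [hne]
  exfalso
  have hn0 : 0 < ‖x - y‖ := norm_pos_iff.2 (sub_ne_zero.2 hne)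
  -- If `x ≠ y`, some `w ∈ ∂R(y)` lies near `v₀ + u`, while `v` lies near `v₀`. Then `v - w` is
  -- close to `-u`, which contradicts monotonicity along `x - y`.
  set u := (δ / ‖x - y‖) • (x - y) with hu
  have hun : ‖u‖ = δ := by
    rw [hu, norm_smul, Real.norm_of_nonneg (by positivity), div_mul_cancel₀ _ hn0.ne']
  have huS : u ∈ S := ⟨by simpa using hun, N.smul_mem _ hxy⟩
  obtain ⟨u', hu't, huu'⟩ := Set.mem_iUnion₂.1 (hcov huS)
  obtain ⟨w, hw, hwn⟩ := hyU hyM u' hu't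
  have hmono := subdiff_monotone hR hv hw
  have h1 : 0 ≤ inner ℝ (v - w) u := by
    rw [hu, inner_smul_right]
    exact mul_nonneg (by positivity) hmono
  have huu : ‖u' - u‖ < δ / 8 := by
    rw [norm_sub_rev]; exact mem_ball_iff_norm.1 huu'
  set e := (v - v₀) - (w - (v₀ + u')) - (u' - u) with he
  have hve : v - w = e - u := by rw [he]; abel
  have hen : ‖e‖ ≤ 3 * (δ / 8) := by
    have h2 := norm_sub_le ((v - v₀) - (w - (v₀ + u'))) (u' - u)
    have h3 := norm_sub_le (v - v₀) (w - (v₀ + u'))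
    rw [← he] at h2
    linarith
  rw [hve, inner_sub_left, real_inner_self_eq_norm_sq, hun] at h1
  have h2 := real_inner_le_norm e u
  rw [hun] at h2
  have h3 := mul_le_mul_of_nonneg_right hen hδ.le
  nlinarith

end Identification

/-! ### Squared step lengths of an inner loop. -/

section StepSum

variable {E : Type*} [NormedAddCommGroup E] {P : ℕ} {y : ℕ → E}

/-- The sum of the squared step lengths of an inner loop. -/
def stepSum (P : ℕ) (y : ℕ → E) : ℝ := ∑ p ∈ Finset.range P, ‖y (p + 1) - y p‖ ^ 2

lemma stepSum_nonneg : 0 ≤ stepSum P y := Finset.sum_nonneg fun _ _ => by positivity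

lemma sq_step_le {p : ℕ} (hp : p < P) : ‖y (p + 1) - y p‖ ^ 2 ≤ stepSum P y :=
  Finset.single_le_sum (f := fun p => ‖y (p + 1) - y p‖ ^ 2) (fun _ _ => by positivity)
    (Finset.mem_range.2 hp)

lemma sq_dist_start_le {p : ℕ} (hp : p ≤ P) : ‖y p - y 0‖ ^ 2 ≤ P * stepSum P y := by
  have h1 : ‖y p - y 0‖ ≤ ∑ q ∈ Finset.range p, ‖y (q + 1) - y q‖ := by
    rw [← Finset.sum_range_sub]
    exact norm_sum_le _ _
  calc ‖y p - y 0‖ ^ 2 ≤ (∑ q ∈ Finset.range p, ‖y (q + 1) - y q‖) ^ 2 :=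
        pow_le_pow_left₀ (norm_nonneg _) h1 2
    _ ≤ p * ∑ q ∈ Finset.range p, ‖y (q + 1) - y q‖ ^ 2 := by
        simpa using sq_sum_le_card_mul_sum_sq (s := Finset.range p)
          (f := fun q => ‖y (q + 1) - y q‖)
    _ ≤ P * stepSum P y := by
        refine mul_le_mul (by exact_mod_cast hp) ?_ (Finset.sum_nonneg fun _ _ => by positivity)
          (by positivity)
        exact Finset.sum_le_sum_of_subset_of_nonneg
          (Finset.range_subset_range.2 hp) fun _ _ _ => by positivity

end StepSum

/-! ### Estimates valid in every realisation of an inner loop. -/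

section Epoch

variable {E : Type*} [NormedAddCommGroup E] [InnerProductSpace ℝ E] {m : ℕ}

/-- The standing assumptions on the data of Prox-SVRG: `F'` is the gradient of `F` and the mean
of the fields `φ j`. -/
structure SVRGData (R : E → EReal) (F : E → ℝ) (F' : E → E) (φ : Fin m → E → E)
    (L γ : ℝ) (P : ℕ) : Prop where
  convex : IsProperConvexLsc R
  gamma_pos : 0 < γ
  lip_nonneg : 0 ≤ L
  length_pos : 0 < P
  step_lt : 4 * L * γ * (P + 1) < 1
  gradient_le : ∀ x y, F x + inner ℝ (F' x) (y - x) ≤ F y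
  lip : ∀ x y, ‖F' x - F' y‖ ≤ L * ‖x - y‖
  lip_term : ∀ j x y, ‖φ j x - φ j y‖ ≤ L * ‖x - y‖
  mean : ∀ x, F' x = (1 / (m : ℝ)) • ∑ j, φ j x

/-- An inner loop of Prox-SVRG. -/
def IsEpoch (R : E → EReal) (F' : E → E) (φ : Fin m → E → E) (γ : ℝ) (P : ℕ)
    (j : ℕ → Fin m) (y : ℕ → E) : Prop :=
  ∀ p < P, IsProx R γ (y p - γ • (φ (j p) (y p) - φ (j p) (y 0) + F' (y 0))) (y (p + 1))

variable {R : E → EReal} {F : E → ℝ} {F' : E → E} {φ : Fin m → E → E} {L γ : ℝ} {P : ℕ}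
  {j : ℕ → Fin m} {y : ℕ → E} {xs : E}

lemma SVRGData.mul_lt (h : SVRGData R F F' φ L γ P) : γ * L * (P + 1) < 1 / 4 := by
  linarith [h.step_lt]

lemma SVRGData.mul_nonneg (h : SVRGData R F F' φ L γ P) : 0 ≤ γ * L :=
  _root_.mul_nonneg h.gamma_pos.le h.lip_nonneg

lemma SVRGData.one_le_length (h : SVRGData R F F' φ L γ P) : (1 : ℝ) ≤ P := by
  exact_mod_cast h.length_pos

lemma SVRGData.mul_le_eighth (h : SVRGData R F F' φ L γ P) : γ * L ≤ 1 / 8 := by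
  nlinarith [h.mul_lt, h.mul_nonneg, h.one_le_length]

/-- Unlike the variance bound, this holds for each index separately, as the realisation-wise
estimates require. -/
lemma SVRGData.error_le (h : SVRGData R F F' φ L γ P) (k : Fin m) (x a : E) :
    ‖φ k x - φ k a + F' a - F' x‖ ≤ 2 * L * ‖x - a‖ := by
  have e : φ k x - φ k a + F' a - F' x = (φ k x - φ k a) - (F' x - F' a) := by abel
  rw [e]
  linarith [norm_sub_le (φ k x - φ k a) (F' x - F' a), h.lip_term k x a, h.lip x a]

lemma IsEpoch.ne_top (h : SVRGData R F F' φ L γ P) (hy : IsEpoch R F' φ γ P j y) {p : ℕ}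
    (hp : p < P) : R (y (p + 1)) ≠ ⊤ :=
  (hy p hp).ne_top h.convex h.gamma_pos

variable [CompleteSpace E]

/-- The objective decreases along every realisation of an inner loop. -/
lemma IsEpoch.gap_le (h : SVRGData R F F' φ L γ P) (hy : IsEpoch R F' φ γ P j y)
    (h0 : R (y 0) ≠ ⊤) :
    2 * γ * gap R F xs (y P) + stepSum P y ≤ 2 * γ * gap R F xs (y 0) := by
  have hγ := h.gamma_pos
  have hP := h.one_le_length
  have hfin : ∀ p ≤ P, R (y p) ≠ ⊤ := by
    intro p hp
    cases p with
    | zero => exact h0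
    | succ p => exact hy.ne_top h hp
  have hstep : ∀ p < P, gap R F xs (y (p + 1)) * γ + (1 - γ * L * (P + 1)) * ‖y (p + 1) - y p‖ ^ 2
      ≤ gap R F xs (y p) * γ + γ * L * stepSum P y := by
    intro p hp
    have hsub := subdiff_real h.convex ((hy p hp).mem_subdiff h.convex hγ) (hy.ne_top h hp)
      (hfin p hp.le)
    have hdes := descent_of_lipschitz h.gradient_le h.lip (y p) (y (p + 1))
    have herr := h.error_le (j p) (y p) (y 0)
    have hdist := sq_dist_start_le (y := y) hp.le
    set S := stepSum P y
    set g := φ (j p) (y p) - φ (j p) (y 0) + F' (y 0) with hg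
    set d := y (p + 1) - y p with hd
    set D := ‖y p - y 0‖ with hD
    have e1 : y p - γ • g - y (p + 1) = -(d + γ • g) := by rw [hd]; abel
    have e2 : y p - y (p + 1) = -d := by rw [hd]; abel
    rw [e1, e2, inner_neg_right, inner_smul_left, inner_neg_left, inner_add_left,
      inner_smul_left, real_inner_self_eq_norm_sq] at hsub
    simp only [conj_trivial] at hsub
    have hin : -(2 * L * D * ‖d‖) ≤ inner ℝ (g - F' (y p)) d :=
      neg_le_of_abs_le ((abs_real_inner_le_norm _ _).trans
        (mul_le_mul_of_nonneg_right herr (norm_nonneg _)))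
    rw [inner_sub_left] at hin
    -- Young's inequality with weight `P`, matched to `D² ≤ P S`.
    have hyoung : 2 * D * ‖d‖ ≤ S + P * ‖d‖ ^ 2 := by
      have h1 : 0 ≤ (D - P * ‖d‖) ^ 2 := sq_nonneg _
      have h2 : P * (2 * D * ‖d‖) ≤ P * (S + P * ‖d‖ ^ 2) := by nlinarith
      exact le_of_mul_le_mul_left h2 (by linarith)
    have hy2 := mul_le_mul_of_nonneg_left hyoung h.mul_nonneg
    have h3 := mul_le_mul_of_nonneg_left hsub hγ.le
    have e3 : γ * ((R (y (p + 1))).toReal + -(γ⁻¹ * -(‖d‖ ^ 2 + γ * inner ℝ g d)))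
        = γ * (R (y (p + 1))).toReal + (‖d‖ ^ 2 + γ * inner ℝ g d) := by field_simp
    rw [e3] at h3
    have h4 := mul_le_mul_of_nonneg_left hdes hγ.le
    have h5 := mul_le_mul_of_nonneg_left hin hγ.le
    unfold gap
    nlinarith
  have hsum : ∀ p ≤ P, gap R F xs (y p) * γ
      + (1 - γ * L * (P + 1)) * ∑ q ∈ Finset.range p, ‖y (q + 1) - y q‖ ^ 2
      ≤ gap R F xs (y 0) * γ + p * (γ * L * stepSum P y) := by
    intro p hp
    induction p with
    | zero => simp
    | succ p ih =>
      have := hstep p hp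
      have := ih (Nat.le_of_succ_le hp)
      rw [Finset.sum_range_succ]
      push_cast
      linarith
  -- The sum loses `P γ L` in noise, which leaves a coefficient of at least `1 - 2γL(P + 1) ≥ 1/2`
  -- in front of the step sum.
  have h1 := hsum P le_rfl
  change _ + _ * stepSum P y ≤ _ at h1
  have h2 := mul_le_mul_of_nonneg_right h.mul_lt.le (stepSum_nonneg (P := P) (y := y))
  have h3 := mul_nonneg h.mul_nonneg (stepSum_nonneg (P := P) (y := y))
  nlinarith

/-- Every inner iterate carries a nearly optimal subgradient. -/
lemma IsEpoch.exists_subgradient (h : SVRGData R F F' φ L γ P) (hy : IsEpoch R F' φ γ P j y)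
    {p : ℕ} (hp : p < P) : ∃ v ∈ subdiff R (y (p + 1)),
      ‖v + F' (y (p + 1))‖ ≤ 2 / γ * √(P * stepSum P y) := by
  have hγ := h.gamma_pos
  have hP := h.one_le_length
  refine ⟨_, (hy p hp).mem_subdiff h.convex hγ, ?_⟩
  set σ := √(P * stepSum P y) with hσ
  have hS := stepSum_nonneg (P := P) (y := y)
  have hD : ‖y p - y 0‖ ≤ σ := Real.le_sqrt_of_sq_le (sq_dist_start_le hp.le)
  have hd : ‖y (p + 1) - y p‖ ≤ σ := Real.le_sqrt_of_sq_le ((sq_step_le hp).trans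
    (le_mul_of_one_le_left hS hP))
  have herr := h.error_le (j p) (y p) (y 0)
  have hlip := h.lip (y (p + 1)) (y p)
  set g := φ (j p) (y p) - φ (j p) (y 0) + F' (y 0)
  have e : γ⁻¹ • (y p - γ • g - y (p + 1)) + F' (y (p + 1))
      = -(γ⁻¹ • (y (p + 1) - y p)) - (g - F' (y p)) + (F' (y (p + 1)) - F' (y p)) := by
    rw [smul_sub, smul_sub, smul_smul, inv_mul_cancel₀ hγ.ne', smul_sub]
    module
  rw [e]
  have h1 := norm_add_le (-(γ⁻¹ • (y (p + 1) - y p)) - (g - F' (y p))) (F' (y (p + 1)) - F' (y p))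
  have h2 := norm_sub_le (-(γ⁻¹ • (y (p + 1) - y p))) (g - F' (y p))
  rw [norm_neg, norm_smul, Real.norm_of_nonneg (by positivity)] at h2
  have h3 : γ⁻¹ * ‖y (p + 1) - y p‖ ≤ γ⁻¹ * σ := mul_le_mul_of_nonneg_left hd (by positivity)
  have h4 : 2 * L * ‖y p - y 0‖ ≤ 2 * L * σ :=
    mul_le_mul_of_nonneg_left hD (by linarith [h.lip_nonneg])
  have h5 : L * ‖y (p + 1) - y p‖ ≤ L * σ := mul_le_mul_of_nonneg_left hd h.lip_nonneg
  -- The three error terms add up to `(γ⁻¹ + 2L + L) σ`.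
  have h6 : 3 * L ≤ γ⁻¹ := by
    rw [← one_div, le_div_iff₀ hγ]
    linarith [h.mul_le_eighth]
  have h7 := mul_le_mul_of_nonneg_right h6 (Real.sqrt_nonneg (P * stepSum P y))
  rw [← hσ] at h7
  have e2 : 2 / γ * σ = 2 * (γ⁻¹ * σ) := by ring
  rw [e2]
  linarith

/-- The final objective excess of an inner loop is controlled by the decrease. -/
lemma IsEpoch.sq_gap_le (h : SVRGData R F F' φ L γ P) (hy : IsEpoch R F' φ γ P j y)
    (h0 : R (y 0) ≠ ⊤) (hxs : R xs ≠ ⊤) (hpos : ∀ x, R x ≠ ⊤ → 0 ≤ gap R F xs x)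
    {Q : ℝ} (hQ : ‖y P - xs‖ ≤ Q) :
    gap R F xs (y P) ^ 2 ≤ 8 * P / γ * Q ^ 2 * (gap R F xs (y 0) - gap R F xs (y P)) := by
  have hγ := h.gamma_pos
  obtain ⟨p, rfl⟩ : ∃ p, P = p + 1 := ⟨P - 1, (Nat.succ_pred_eq_of_pos h.length_pos).symm⟩
  obtain ⟨v, hv, hvn⟩ := hy.exists_subgradient h (Nat.lt_succ_self p)
  have hS := stepSum_nonneg (P := p + 1) (y := y)
  have hdec := hy.gap_le (xs := xs) h h0
  have hfin := hy.ne_top h (Nat.lt_succ_self p)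
  have h1 := subdiff_real h.convex hv hfin hxs
  have h2 := h.gradient_le (y (p + 1)) xs
  set σ := √((p + 1 : ℕ) * stepSum (p + 1) y) with hσ
  have hσ2 : σ ^ 2 = (p + 1 : ℕ) * stepSum (p + 1) y := Real.sq_sqrt (by positivity)
  -- By convexity the excess is at most the pairing of a subgradient of the objective with `y - xs`;
  -- squaring turns `σ²` into the step sum, hence into the decrease.
  have h3 : gap R F xs (y (p + 1)) ≤ 2 / γ * σ * Q := by
    have h4 : inner ℝ (v + F' (y (p + 1))) (y (p + 1) - xs) ≤ 2 / γ * σ * Q :=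
      (real_inner_le_norm _ _).trans (mul_le_mul hvn hQ (norm_nonneg _) (by positivity))
    rw [← neg_sub (y (p + 1)) xs, inner_neg_right] at h1 h2
    rw [inner_add_left] at h4
    unfold gap
    linarith
  calc gap R F xs (y (p + 1)) ^ 2 ≤ (2 / γ * σ * Q) ^ 2 := pow_le_pow_left₀ (hpos _ hfin) h3 2
    _ = 4 * (p + 1 : ℕ) / γ ^ 2 * Q ^ 2 * stepSum (p + 1) y := by
        rw [mul_pow, mul_pow, hσ2]; ring
    _ ≤ 4 * (p + 1 : ℕ) / γ ^ 2 * Q ^ 2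
          * (2 * γ * (gap R F xs (y 0) - gap R F xs (y (p + 1)))) := by
        refine mul_le_mul_of_nonneg_left ?_ (by positivity)
        linarith
    _ = _ := by field_simp; ring

/-- Uniform rate for sequences with `D (n+1) ^ 2 ≤ C (D n - D (n+1))`. -/
lemma exists_uniform_index {B C η : ℝ} (hη : 0 < η) : ∃ N : ℕ, ∀ D : ℕ → ℝ, D 0 ≤ B →
    (∀ n, 0 ≤ D n) → (∀ n, D (n + 1) ≤ D n) → (∀ n, D (n + 1) ^ 2 ≤ C * (D n - D (n + 1))) →
    0 ≤ C → ∀ n ≥ N, D n ≤ η := by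
  obtain ⟨N, hN⟩ := exists_nat_gt (C * B / η ^ 2)
  refine ⟨N, fun D hB h0 hd hC hC0 n hn => ?_⟩
  have hanti : Antitone D := antitone_nat_of_succ_le hd
  refine (hanti hn).trans ?_
  by_contra! hlt
  -- Telescoping, with every `D (k+1)` replaced by the smaller `D N`. If `D N > η`, then `N η² ≤ C
  -- B`, against the choice of `N`.
  have hsum : ∀ k ≤ N, k * D N ^ 2 ≤ C * (D 0 - D k) := by
    intro k hk
    induction k with
    | zero => simp
    | succ k ih =>
      have h1 := ih (Nat.le_of_succ_le hk)
      have h2 := hC k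
      have h3 : D N ^ 2 ≤ D (k + 1) ^ 2 := pow_le_pow_left₀ (h0 N) (hanti hk) 2
      push_cast
      nlinarith
  have h1 := hsum N le_rfl
  have h2 : C * (D 0 - D N) ≤ C * B := mul_le_mul_of_nonneg_left (by linarith [h0 N]) hC0
  rw [div_lt_iff₀ (by positivity)] at hN
  have h3 : η ^ 2 ≤ D N ^ 2 := pow_le_pow_left₀ hη.le hlt.le 2
  have h4 : (N : ℝ) * η ^ 2 ≤ N * D N ^ 2 := mul_le_mul_of_nonneg_left h3 (by positivity)
  linarith

/-- All realisations of Prox-SVRG reach, and stay in, a sublevel set after a deterministic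
number of inner loops. -/
lemma exists_uniform_epoch (h : SVRGData R F F' φ L γ P) (hxs : R xs ≠ ⊤)
    (hpos : ∀ x, R x ≠ ⊤ → 0 ≤ gap R F xs x) {c r : ℝ} (hc : 0 < c) (hr : 0 < r)
    (hout : ∀ x, R x ≠ ⊤ → r ≤ ‖x - xs‖ → c * r * ‖x - xs‖ ≤ gap R F xs x)
    (B : ℝ) {η : ℝ} (hη : 0 < η) : ∃ N : ℕ, ∀ (i : ℕ → ℕ → Fin m) (x : ℕ → ℕ → E),
      (∀ ℓ, IsEpoch R F' φ γ P (i ℓ) (x ℓ)) → (∀ ℓ, x (ℓ + 1) 0 = x ℓ P) → R (x 0 0) ≠ ⊤ →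
      gap R F xs (x 0 0) ≤ B → ∀ ℓ ≥ N, R (x ℓ 0) ≠ ⊤ ∧ gap R F xs (x ℓ 0) ≤ η := by
  have hγ := h.gamma_pos
  obtain ⟨N, hN⟩ := exists_uniform_index (B := B) (C := 8 * P / γ * (r + B / (c * r)) ^ 2) hη
  refine ⟨N, fun i x hx hnext h0 hB ℓ hℓ => ?_⟩
  have hfin : ∀ ℓ, R (x ℓ 0) ≠ ⊤ := by
    intro ℓ
    cases ℓ with
    | zero => exact h0
    | succ ℓ =>
      rw [hnext]
      obtain ⟨p, hp⟩ : ∃ p, P = p + 1 := ⟨P - 1, (Nat.succ_pred_eq_of_pos h.length_pos).symm⟩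
      have := (hx ℓ).ne_top h (p := p) (by omega)
      rwa [← hp] at this
  have hdec : ∀ ℓ, gap R F xs (x (ℓ + 1) 0) ≤ gap R F xs (x ℓ 0) := by
    intro ℓ
    have h1 := (hx ℓ).gap_le (xs := xs) h (hfin ℓ)
    rw [hnext]
    have h2 := stepSum_nonneg (P := P) (y := x ℓ)
    nlinarith
  have hle : ∀ ℓ, gap R F xs (x ℓ 0) ≤ B := by
    intro ℓ
    induction ℓ with
    | zero => exact hB
    | succ ℓ ih => exact (hdec ℓ).trans ih
  have hB0 : 0 ≤ B := (hpos _ h0).trans hB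
  refine ⟨hfin ℓ, hN (fun ℓ => gap R F xs (x ℓ 0)) hB (fun n => hpos _ (hfin n)) hdec ?_
    (by positivity) ℓ hℓ⟩
  intro n
  -- Outside the `r`-ball the growth is linear, so excess at most `B` bounds the distance by `B / (c
  -- r)`.
  have hQ : ‖x n P - xs‖ ≤ r + B / (c * r) := by
    rw [← hnext]
    by_cases hrn : r ≤ ‖x (n + 1) 0 - xs‖
    · have h1 := (hout _ (hfin _) hrn).trans (hle _)
      have h2 : ‖x (n + 1) 0 - xs‖ ≤ B / (c * r) := by
        rw [le_div_iff₀ (by positivity)]; linarith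
      linarith
    · have : 0 ≤ B / (c * r) := by positivity
      linarith
  have := (hx n).sq_gap_le h (hfin n) hxs hpos hQ
  simpa only [hnext] using this

end Epoch

/-! ### Deterministic contraction of the first inner step near the minimiser. -/

section LocalContraction

/-- Here `u₀`, `u₁` are squared distances before and after the step, `d` is the squared step length
and `κ² d / 8` the noise it creates later. If `A/b ≥ κ²/2`, the step's own gain `3/4 d` absorbs this
noise at rate `A/b`. Otherwise `u₁` is so small that `d ≤ 3 u₀`, and the total is below `κ² u₀ ≤ κ
u₀`. -/
lemma contraction_of_step {A b c κ ε u₀ u₁ d : ℝ} (hA : 0 < A) (hA1 : A ≤ 1) (hb : 1 ≤ b)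
    (hc : 0 ≤ c) (hc1 : c ≤ 1) (hε : (A + ε) * b ≤ A * (b + c)) (hκ0 : 0 ≤ κ) (hκ1 : κ < 1)
    (hu₀ : 0 ≤ u₀) (hd0 : 0 ≤ d) (hd : d ≤ 2 * (u₀ + u₁))
    (h : (b + c) * u₁ + 3 / 4 * d ≤ (A + ε) * u₀) :
    u₁ + κ ^ 2 / 8 * d ≤ max (A / b) κ * u₀ := by
  have hb0 : 0 < b := by linarith
  have hW : 0 < b + c := by linarith
  set a := A / b with ha
  have hab : a * b = A := div_mul_cancel₀ _ hb0.ne'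
  have ha0 : 0 < a := div_pos hA hb0
  have hAW : A + ε ≤ a * (b + c) := by
    have : (A + ε) * b ≤ a * (b + c) * b := by rw [mul_right_comm, hab]; exact hε
    exact le_of_mul_le_mul_right this hb0
  have h1 : u₁ + 3 / 4 / (b + c) * d ≤ a * u₀ := by
    have : (b + c) * (u₁ + 3 / 4 / (b + c) * d) ≤ (b + c) * (a * u₀) := by
      have e : (b + c) * (u₁ + 3 / 4 / (b + c) * d) = (b + c) * u₁ + 3 / 4 * d := by
        field_simp
      rw [e]
      have := mul_le_mul_of_nonneg_right hAW hu₀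
      linarith
    exact le_of_mul_le_mul_left this hW
  have hκ2 : κ ^ 2 ≤ κ := by nlinarith
  rcases le_or_gt (κ ^ 2 / 2) a with hcase | hcase
  · have h2 : κ ^ 2 / 8 ≤ 3 / 4 / (b + c) := by
      rw [le_div_iff₀ hW]
      have h3 := mul_le_mul_of_nonneg_right hcase hb0.le
      rw [hab] at h3
      nlinarith [sq_nonneg κ]
    calc u₁ + κ ^ 2 / 8 * d ≤ u₁ + 3 / 4 / (b + c) * d := by
          linarith [mul_le_mul_of_nonneg_right h2 hd0]
      _ ≤ a * u₀ := h1
      _ ≤ max a κ * u₀ := mul_le_mul_of_nonneg_right (le_max_left _ _) hu₀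
  · have h2 : u₁ ≤ a * u₀ := by
      have : 0 ≤ 3 / 4 / (b + c) * d := by positivity
      linarith
    have h3 : a * u₀ ≤ κ ^ 2 / 2 * u₀ := mul_le_mul_of_nonneg_right hcase.le hu₀
    have h4 : d ≤ 3 * u₀ := by nlinarith
    have h5 : κ ^ 2 / 8 * d ≤ κ ^ 2 / 8 * (3 * u₀) := mul_le_mul_of_nonneg_left h4 (by positivity)
    calc u₁ + κ ^ 2 / 8 * d ≤ κ ^ 2 * u₀ := by nlinarith [sq_nonneg κ]
      _ ≤ κ * u₀ := mul_le_mul_of_nonneg_right hκ2 hu₀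
      _ ≤ max a κ * u₀ := mul_le_mul_of_nonneg_right (le_max_right _ _) hu₀

variable {E : Type*} [NormedAddCommGroup E] [InnerProductSpace ℝ E] [FiniteDimensional ℝ E]
  {m : ℕ} {R : E → EReal} {F : E → ℝ} {φ : Fin m → E → E} {L γ : ℝ} {P : ℕ} {xs : E} {M : Set E}

/-- The restricted modulus gives curvature along the manifold, up to `ε`. -/
lemma exists_curvature_ball (hM : PartlySmooth R xs M) (hd : Differentiable ℝ F)
    (hc : ∀ x y, F x + inner ℝ (gradient F x) (y - x) ≤ F y) (hF : ContDiffAt ℝ 2 F xs)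
    {α : ℝ} (hα0 : 0 ≤ α)
    (hα : ∀ h ∈ modelSubspace R xs, α * ‖h‖ ^ 2 ≤ inner ℝ h (hessian F xs h))
    {ε : ℝ} (hε : 0 < ε) : ∃ r > 0, ∀ x ∈ M, ‖x - xs‖ ≤ r →
      F x + inner ℝ (gradient F x) (xs - x) + (α - ε) / 2 * ‖xs - x‖ ^ 2 ≤ F xs := by
  set H := hessian F xs
  set T := modelSubspace R xs
  -- On the manifold the normal part of `w` is at most `e ‖w‖`; this choice limits its effect on the
  -- Hessian form to `ε/2 ‖w‖²`. Half of that, together with the Taylor error `ε/4 ‖w‖²`, gives the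
  -- stated loss.
  set e := min 1 (ε / (2 * (α + 2 * ‖H‖ + 1))) with he
  have he0 : 0 < e := lt_min one_pos (by positivity)
  have he1 : e ≤ 1 := min_le_left _ _
  have he2 : e * (α + 2 * ‖H‖) ≤ ε / 2 := by
    have h1 : e * (2 * (α + 2 * ‖H‖ + 1)) ≤ ε := by
      have := mul_le_mul_of_nonneg_right (min_le_right 1 (ε / (2 * (α + 2 * ‖H‖ + 1))))
        (show 0 ≤ 2 * (α + 2 * ‖H‖ + 1) by positivity)
      rwa [div_mul_cancel₀ _ (by positivity), ← he] at this
    nlinarith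
  obtain ⟨r₁, hr₁, htan⟩ := hM.exists_tangent_ball he0
  obtain ⟨r₂, hr₂, htay⟩ := exists_taylor_ball hd hF (show 0 < ε / 4 by positivity)
  refine ⟨min r₁ r₂, lt_min hr₁ hr₂, fun x hx hxr => ?_⟩
  have h1 := htan x hx (hxr.trans (min_le_left _ _))
  have h2 := (htay x (hxr.trans (min_le_right _ _))).2
  rw [norm_sub_rev xs x]
  set w := x - xs
  set t := T.starProjection w
  have htT : t ∈ T := T.starProjection_apply_mem w
  have h3 := inner_hessian_ge hc hF (hα t htT) (T.norm_starProjection_apply_le w)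
  have hsq : ‖w‖ ^ 2 = ‖t‖ ^ 2 + ‖w - t‖ ^ 2 := by
    have h4 : inner ℝ t (w - t) = 0 :=
      Submodule.inner_right_of_mem_orthogonal htT (T.sub_starProjection_mem_orthogonal w)
    have h5 := norm_add_sq_real t (w - t)
    rw [add_sub_cancel, h4] at h5
    linarith
  set n := ‖w - t‖
  have hn2 : n ^ 2 ≤ e * ‖w‖ ^ 2 := by
    calc n ^ 2 ≤ (e * ‖w‖) ^ 2 := pow_le_pow_left₀ (norm_nonneg _) h1 2
      _ = e * (e * ‖w‖ ^ 2) := by ring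
      _ ≤ 1 * (e * ‖w‖ ^ 2) := mul_le_mul_of_nonneg_right he1 (by positivity)
      _ = _ := one_mul _
  have h6 : ‖H‖ * ‖w‖ * n ≤ ‖H‖ * (e * ‖w‖ ^ 2) := by
    calc ‖H‖ * ‖w‖ * n ≤ ‖H‖ * ‖w‖ * (e * ‖w‖) := mul_le_mul_of_nonneg_left h1 (by positivity)
      _ = _ := by ring
  have h7 : α * n ^ 2 ≤ α * (e * ‖w‖ ^ 2) := mul_le_mul_of_nonneg_left hn2 hα0
  have h8 := mul_le_mul_of_nonneg_right he2 (sq_nonneg ‖w‖)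
  nlinarith

/-- The first (noise free) inner step contracts near `xs`. -/
lemma exists_contraction_ball (h : SVRGData R F (gradient F) φ L γ P) (hM : PartlySmooth R xs M)
    (hd : Differentiable ℝ F) (hF : ContDiffAt ℝ 2 F xs) {c r₀ : ℝ} (hc : 0 < c) (hr₀ : 0 < r₀)
    (hg : ∀ x, ‖x - xs‖ ≤ r₀ → R x ≠ ⊤ → c * ‖x - xs‖ ^ 2 ≤ gap R F xs x)
    {αF αR : ℝ} (hαF0 : 0 ≤ αF) (hαR0 : 0 ≤ αR)
    (hαF : IsRestrictedModulus F (modelSubspace R xs) xs αF)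
    (hαR : IsStrongModulusAlong R M xs αR) :
    ∃ r > 0, ∀ x ∈ M, ∀ x₁ ∈ M, ‖x - xs‖ ≤ r → ‖x₁ - xs‖ ≤ r →
      IsProx R γ (x - γ • gradient F x) x₁ →
      ‖x₁ - xs‖ ^ 2 + (4 * L * γ * (P + 1)) ^ 2 / 8 * ‖x₁ - x‖ ^ 2
        ≤ svrgRate L γ αF αR P * ‖x - xs‖ ^ 2 := by
  have hγ := h.gamma_pos
  set T := modelSubspace R xs with hT
  set κ := 4 * L * γ * (P + 1) with hκ
  have hκ0 : 0 ≤ κ := by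
    have := h.lip_nonneg
    positivity
  have hκ1 : κ < 1 := h.step_lt
  -- When `T` is trivial, the bound `αF ≤ L` is unavailable, as there is no vector to test it on.
  -- But then the manifold reduces to `xs` nearby, so the step lands on `xs` exactly.
  by_cases hbot : T = ⊥
  · obtain ⟨r, hr, htan⟩ := hM.exists_tangent_ball (show (0 : ℝ) < 1 / 2 by norm_num)
    refine ⟨r, hr, fun x _ x₁ hx₁ _ hr₁ _ => ?_⟩
    have h1 := htan x₁ hx₁ hr₁
    rw [← hT] at h1
    have h2 : T.starProjection (x₁ - xs) = 0 := by
      have h3 := T.starProjection_apply_mem (x₁ - xs)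
      have h4 : ∀ z ∈ T, z = 0 := (Submodule.eq_bot_iff T).1 hbot
      exact h4 _ h3
    rw [h2, sub_zero] at h1
    have h3 : x₁ - xs = 0 := norm_le_zero_iff.1 (by linarith)
    rw [sub_eq_zero.1 h3, sub_self, norm_zero, norm_sub_rev xs x]
    have h4 : κ ^ 2 / 8 ≤ svrgRate L γ αF αR P := by
      refine le_trans ?_ (le_max_right _ _)
      rw [← hκ]
      nlinarith
    have := mul_le_mul_of_nonneg_right h4 (sq_nonneg ‖x - xs‖)
    linarith
  obtain ⟨rF, hrF, hmF⟩ := hαF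
  obtain ⟨rR, hrR, hmR⟩ := hαR
  have hmod : ∀ h ∈ T, αF * ‖h‖ ^ 2 ≤ inner ℝ h (hessian F xs h) :=
    hmF xs (by simpa using hrF.le)
  have hαL : αF ≤ L := by
    obtain ⟨z, hz, hz0⟩ := T.ne_bot_iff.1 hbot
    have hlip : LipschitzWith L.toNNReal (gradient F) := LipschitzWith.of_dist_le_mul fun a b => by
      rw [dist_eq_norm, dist_eq_norm, Real.coe_toNNReal _ h.lip_nonneg]
      exact h.lip a b
    have h1 : ‖hessian F xs‖ ≤ L := by
      have := norm_fderiv_le_of_lipschitz ℝ (x₀ := xs) hlip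
      rwa [Real.coe_toNNReal _ h.lip_nonneg] at this
    have h2 : inner ℝ z (hessian F xs z) ≤ L * ‖z‖ ^ 2 := by
      refine (real_inner_le_norm _ _).trans ?_
      have h3 := (hessian F xs).le_of_opNorm_le h1 z
      nlinarith [norm_nonneg z, mul_le_mul_of_nonneg_left h3 (norm_nonneg z)]
    have h3 := (hmod z hz).trans h2
    exact le_of_mul_le_mul_right h3 (by positivity)
  set A := 1 - γ * αF with hA
  set b := 1 + γ * αR with hb
  have hA0 : 0 < A := by
    have := mul_le_mul_of_nonneg_left hαL hγ.le
    linarith [h.mul_le_eighth]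
  have hb1 : 1 ≤ b := by
    have : 0 ≤ γ * αR := by positivity
    linarith
  set c' := min (2 * γ * c) 1 with hc'
  have hc'0 : 0 < c' := lt_min (by positivity) one_pos
  -- Chosen so that `(A + γ ε) / (b + c') = A / b`: the growth term `c'` exactly compensates the
  -- curvature loss `ε`, and the rate is attained without slack.
  set ε := A * c' / (b * γ) with hε
  have hε0 : 0 < ε := by positivity
  have hεγ : (A + γ * ε) * b = A * (b + c') := by
    rw [hε]; field_simp
  obtain ⟨r₁, hr₁, hcurv⟩ := exists_curvature_ball hM hd h.gradient_le hF hαF0 hmod hε0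
  refine ⟨min (min r₀ r₁) rR, by positivity, fun x hx x₁ hx₁ hxr hx₁r hp => ?_⟩
  have hxs : R xs ≠ ⊤ := by
    obtain ⟨v, hv⟩ := hM.subdiff_nonempty
    exact ne_top_of_mem_subdiff h.convex hv
  have hx₁t := hp.ne_top h.convex hγ
  have hα : (R x₁).toReal + inner ℝ (γ⁻¹ • (x - γ • gradient F x - x₁)) (xs - x₁)
      + αR / 2 * ‖xs - x₁‖ ^ 2 ≤ (R xs).toReal := by
    have h1 := hmR x₁ hx₁ xs hM.mem (hx₁r.trans (min_le_right _ _)) (by simpa using hrR.le) _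
      (hp.mem_subdiff h.convex hγ)
    rw [← h.convex.coe_toReal hx₁t, ← h.convex.coe_toReal hxs, ← EReal.coe_add,
      EReal.coe_le_coe_iff] at h1
    linarith
  have hstep := prox_step hγ h.gradient_le h.lip hα
    (hcurv x hx (hxr.trans ((min_le_left _ _).trans (min_le_right _ _))))
  rw [sub_self, inner_zero_left, mul_zero, sub_zero] at hstep
  have hgrow := hg x₁ (hx₁r.trans ((min_le_left _ _).trans (min_le_left _ _))) hx₁t
  have h1 : c' * ‖x₁ - xs‖ ^ 2 ≤ 2 * γ * gap R F xs x₁ := by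
    have h2 := mul_le_mul_of_nonneg_right (min_le_left (2 * γ * c) 1) (sq_nonneg ‖x₁ - xs‖)
    have h3 := mul_le_mul_of_nonneg_left hgrow (show 0 ≤ 2 * γ by positivity)
    linarith
  have h2 : 3 / 4 * ‖x₁ - x‖ ^ 2 ≤ (1 - 2 * γ * L) * ‖x₁ - x‖ ^ 2 :=
    mul_le_mul_of_nonneg_right (by linarith [h.mul_le_eighth]) (sq_nonneg _)
  refine contraction_of_step hA0 (sub_le_self _ (by positivity)) hb1 hc'0.le (min_le_right _ _) hεγ.le
    hκ0 hκ1 (sq_nonneg _) (sq_nonneg _) ?_ ?_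
  · have h3 := norm_sub_le (x₁ - xs) (x - xs)
    rw [sub_sub_sub_cancel_right] at h3
    have h4 := pow_le_pow_left₀ (norm_nonneg _) h3 2
    nlinarith [sq_nonneg (‖x₁ - xs‖ - ‖x - xs‖)]
  · have h3 : 1 - γ * (αF - ε) = A + γ * ε := by rw [hA]; ring
    rw [h3] at hstep
    linarith

/-- Low objective values keep a whole inner loop, and its subgradients, near `xs`. -/
lemma exists_near_level {F' : E → E} (h : SVRGData R F F' φ L γ P)
    (hFc : ConvexOn ℝ Set.univ F) (hxs : R xs ≠ ⊤)
    (hpos : ∀ x, R x ≠ ⊤ → 0 ≤ gap R F xs x) {c r₀ : ℝ} (hc : 0 < c) (hr₀ : 0 < r₀)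
    (hg : ∀ x, ‖x - xs‖ ≤ r₀ → R x ≠ ⊤ → c * ‖x - xs‖ ^ 2 ≤ gap R F xs x) {s : ℝ} (hs : 0 < s) :
    ∃ η > 0, ∀ (j : ℕ → Fin m) (y : ℕ → E), IsEpoch R F' φ γ P j y → R (y 0) ≠ ⊤ →
      gap R F xs (y 0) ≤ η → ‖y 0 - xs‖ ≤ s ∧ ∀ p < P, ‖y (p + 1) - xs‖ ≤ s ∧
        ∃ v ∈ subdiff R (y (p + 1)), ‖v + F' xs‖ < s := by
  have hγ := h.gamma_pos
  have hP := h.one_le_length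
  have hL := h.lip_nonneg
  -- The sublevel set at height `c s'²` lies in the `s'`-ball. The bound `s / (4 (L + 1))` controls
  -- the variation of the gradient, and `τ` below bounds both the drift within a loop and, after
  -- multiplication by `2/γ`, the subgradient residual.
  set s' := min (min r₀ (s / 4)) (s / (4 * (L + 1))) with hs'
  have hs'0 : 0 < s' := by positivity
  set τ := min (s / 4) (γ * s / 8) with hτ
  have hτ0 : 0 < τ := by positivity
  refine ⟨min (c * s' ^ 2) (τ ^ 2 / (2 * γ * P)), by positivity, fun j y hy h0 hη => ?_⟩
  have hnear : ∀ x, R x ≠ ⊤ → gap R F xs x ≤ c * s' ^ 2 → ‖x - xs‖ ≤ s' := by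
    intro x hx hgx
    by_contra! hlt
    have h1 := gap_growth_outside h.convex hFc hxs hs'0 (fun z hz => hg z
      (hz.trans ((min_le_left _ _).trans (min_le_left _ _)))) hx hlt.le
    have h2 : c * s' * s' < c * s' * ‖x - xs‖ := mul_lt_mul_of_pos_left hlt (by positivity)
    nlinarith
  have hdec := hy.gap_le (xs := xs) h h0
  have hs4 : s' ≤ s / 4 := (min_le_left _ _).trans (min_le_right _ _)
  have hy0 := hnear _ h0 (hη.trans (min_le_left _ _))
  refine ⟨by linarith, fun p hp => ?_⟩
  have hPfin : R (y P) ≠ ⊤ := by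
    obtain ⟨q, rfl⟩ : ∃ q, P = q + 1 := ⟨P - 1, (Nat.succ_pred_eq_of_pos h.length_pos).symm⟩
    exact hy.ne_top h (Nat.lt_succ_self q)
  have hσ : √(P * stepSum P y) ≤ τ := by
    refine Real.sqrt_le_iff.2 ⟨hτ0.le, ?_⟩
    have h1 := hpos _ hPfin
    have h2 : stepSum P y ≤ 2 * γ * (τ ^ 2 / (2 * γ * P)) := by
      have := mul_le_mul_of_nonneg_left (hη.trans (min_le_right _ _)) (show 0 ≤ 2 * γ by positivity)
      nlinarith
    calc P * stepSum P y ≤ P * (2 * γ * (τ ^ 2 / (2 * γ * P))) :=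
          mul_le_mul_of_nonneg_left h2 (by positivity)
      _ = τ ^ 2 := by field_simp
  have hdist : ‖y (p + 1) - y 0‖ ≤ τ :=
    (Real.le_sqrt_of_sq_le (sq_dist_start_le hp)).trans hσ
  have htri := norm_add_le (y (p + 1) - y 0) (y 0 - xs)
  rw [sub_add_sub_cancel] at htri
  have hτs : τ ≤ s / 4 := min_le_left _ _
  have hns : ‖y (p + 1) - xs‖ ≤ s := by linarith
  refine ⟨hns, ?_⟩
  obtain ⟨v, hv, hvn⟩ := hy.exists_subgradient h hp
  refine ⟨v, hv, ?_⟩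
  have h1 : ‖v + F' (y (p + 1))‖ ≤ s / 4 := by
    calc _ ≤ 2 / γ * √(P * stepSum P y) := hvn
      _ ≤ 2 / γ * (γ * s / 8) :=
          mul_le_mul_of_nonneg_left (hσ.trans (min_le_right _ _)) (by positivity)
      _ = s / 4 := by field_simp; norm_num
  have h2 : L * s' ≤ s / 4 := by
    have := mul_le_mul_of_nonneg_left (min_le_right (min r₀ (s / 4)) (s / (4 * (L + 1))))
      (show 0 ≤ L + 1 by positivity)
    rw [← hs', show (L + 1) * (s / (4 * (L + 1))) = s / 4 by field_simp] at this
    linarith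
  have h3 : L * τ ≤ s / 8 := by
    have := mul_le_mul_of_nonneg_left (min_le_right (s / 4) (γ * s / 8)) hL
    have h4 := mul_le_mul_of_nonneg_right h.mul_le_eighth (show 0 ≤ s / 8 by positivity)
    rw [← hτ] at this
    nlinarith
  have h4 : ‖F' (y (p + 1)) - F' xs‖ ≤ s / 4 + s / 8 := by
    refine (h.lip _ _).trans ?_
    have := mul_le_mul_of_nonneg_left (show ‖y (p + 1) - xs‖ ≤ τ + s' by linarith) hL
    linarith
  have h5 := norm_sub_le (v + F' (y (p + 1))) (F' (y (p + 1)) - F' xs)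
  rw [show v + F' (y (p + 1)) - (F' (y (p + 1)) - F' xs) = v + F' xs by abel] at h5
  linarith

/-- After a deterministic number of inner loops, the first inner step contracts in every
realisation. -/
lemma exists_uniform_contraction (h : SVRGData R F (gradient F) φ L γ P)
    (hFc : ConvexOn ℝ Set.univ F) (hM : PartlySmooth R xs M) (hd : Differentiable ℝ F)
    (hF : ContDiffAt ℝ 2 F xs) (hpos : ∀ x, R x ≠ ⊤ → 0 ≤ gap R F xs x)
    (hND : -gradient F xs ∈ intrinsicInterior ℝ (subdiff R xs))
    {c r₀ : ℝ} (hc : 0 < c) (hr₀ : 0 < r₀)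
    (hg : ∀ x, ‖x - xs‖ ≤ r₀ → R x ≠ ⊤ → c * ‖x - xs‖ ^ 2 ≤ gap R F xs x)
    {αF αR : ℝ} (hαF0 : 0 ≤ αF) (hαR0 : 0 ≤ αR)
    (hαF : IsRestrictedModulus F (modelSubspace R xs) xs αF)
    (hαR : IsStrongModulusAlong R M xs αR) (B : ℝ) :
    ∃ N : ℕ, ∀ (i : ℕ → ℕ → Fin m) (x : ℕ → ℕ → E),
      (∀ ℓ, IsEpoch R (gradient F) φ γ P (i ℓ) (x ℓ)) → (∀ ℓ, x (ℓ + 1) 0 = x ℓ P) →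
      R (x 0 0) ≠ ⊤ → gap R F xs (x 0 0) ≤ B → ∀ ℓ ≥ N,
      ‖x ℓ 1 - xs‖ ^ 2 + (4 * L * γ * (P + 1)) ^ 2 / 8 * ‖x ℓ 1 - x ℓ 0‖ ^ 2
        ≤ svrgRate L γ αF αR P * ‖x ℓ 0 - xs‖ ^ 2 := by
  have hxs : R xs ≠ ⊤ := by
    obtain ⟨v, hv⟩ := hM.subdiff_nonempty
    exact ne_top_of_mem_subdiff h.convex hv
  obtain ⟨δ, hδ, hball⟩ := exists_ball_of_mem_intrinsicInterior hND
  rw [← vectorSpan_subdiff_eq] at hball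
  obtain ⟨rI, hrI, hid⟩ := hM.identification h.convex hδ hball
  obtain ⟨rC, hrC, hcon⟩ := exists_contraction_ball h hM hd hF hc hr₀ hg hαF0 hαR0 hαF hαR
  set s := min (rI / 2) rC with hs
  have hs0 : 0 < s := by positivity
  have hsI : s < rI := (min_le_left _ _).trans_lt (half_lt_self hrI)
  obtain ⟨η, hη, hnear⟩ := exists_near_level h hFc hxs hpos hc hr₀ hg hs0
  obtain ⟨N, hN⟩ := exists_uniform_epoch h hxs hpos hc hr₀
    (fun x hx hr => gap_growth_outside h.convex hFc hxs hr₀ hg hx hr) B hη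
  -- One extra loop: an outer iterate is known to lie on the manifold only as the last inner iterate
  -- of an earlier controlled loop.
  refine ⟨N + 1, fun i x hx hnext h0 hB ℓ hℓ => ?_⟩
  have hin : ∀ k ≥ N, ‖x k 0 - xs‖ ≤ s ∧ ∀ p < P, ‖x k (p + 1) - xs‖ ≤ s ∧ x k (p + 1) ∈ M := by
    intro k hk
    obtain ⟨h1, h2⟩ := hN i x hx hnext h0 hB k hk
    obtain ⟨h3, h4⟩ := hnear (i k) (x k) (hx k) h1 h2
    refine ⟨h3, fun p hp => ?_⟩
    obtain ⟨h5, v, hv, hvn⟩ := h4 p hp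
    refine ⟨h5, hid _ v (h5.trans_lt hsI) hv ?_⟩
    rw [sub_neg_eq_add]
    exact hvn.trans hsI
  obtain ⟨k, rfl⟩ : ∃ k, ℓ = k + 1 := ⟨ℓ - 1, by omega⟩
  obtain ⟨q, hq⟩ : ∃ q, P = q + 1 := ⟨P - 1, (Nat.succ_pred_eq_of_pos h.length_pos).symm⟩
  have hxM : x (k + 1) 0 ∈ M := by
    rw [hnext, hq]
    exact ((hin k (by omega)).2 q (by omega)).2
  have h1 := hin (k + 1) (by omega)
  have h2 := h1.2 0 h.length_pos
  have h3 := hx (k + 1) 0 h.length_pos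
  -- At `p = 0` the iterate equals the snapshot, so the stochastic gradient is exact.
  rw [sub_self, zero_add] at h3
  exact hcon _ hxM _ h2.2 (h1.1.trans (min_le_right _ _)) (h2.1.trans (min_le_right _ _)) h3

end LocalContraction

/-! ### Functions of finitely many samples, and averaging over a fresh one. -/

section Sampling

variable {Ω : Type*} {m : ℕ} {β β' δ : Type*} {i : ℕ → Ω → Fin m} {k l : ℕ}

/-- The first `k` sampled indices. -/
def hist (i : ℕ → Ω → Fin m) (k : ℕ) (ω : Ω) : Finset.range k → Fin m := fun q => i q ω

/-- `g` is a function of the first `k` sampled indices. -/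
def DependsOnHist (i : ℕ → Ω → Fin m) (k : ℕ) (g : Ω → β) : Prop :=
  ∃ X : (Finset.range k → Fin m) → β, ∀ ω, g ω = X (hist i k ω)

lemma DependsOnHist.mono {g : Ω → β} (h : DependsOnHist i k g) (hkl : k ≤ l) :
    DependsOnHist i l g := by
  obtain ⟨X, hX⟩ := h
  exact ⟨fun a => X fun q => a ⟨q, Finset.range_subset_range.2 hkl q.2⟩, fun ω => hX ω⟩

lemma dependsOnHist_const (b : β) : DependsOnHist i k (fun _ => b) := ⟨fun _ => b, fun _ => rfl⟩

lemma dependsOnHist_sample : DependsOnHist i (k + 1) (i k) :=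
  ⟨fun a => a ⟨k, Finset.self_mem_range_succ k⟩, fun _ => rfl⟩

lemma DependsOnHist.comp {g : Ω → β} (h : DependsOnHist i k g) (f : β → δ) :
    DependsOnHist i k (fun ω => f (g ω)) := by
  obtain ⟨X, hX⟩ := h
  exact ⟨fun a => f (X a), fun ω => congrArg f (hX ω)⟩

lemma DependsOnHist.comp₂ {g : Ω → β} {g' : Ω → β'} (h : DependsOnHist i k g)
    (h' : DependsOnHist i k g') (f : β → β' → δ) :
    DependsOnHist i k (fun ω => f (g ω) (g' ω)) := by
  obtain ⟨X, hX⟩ := h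
  obtain ⟨Y, hY⟩ := h'
  exact ⟨fun a => f (X a) (Y a), fun ω => congrArg₂ f (hX ω) (hY ω)⟩

lemma DependsOnHist.sum {ι : Type*} {t : Finset ι} {g : ι → Ω → ℝ}
    (h : ∀ a ∈ t, DependsOnHist i k (g a)) : DependsOnHist i k (fun ω => ∑ a ∈ t, g a ω) := by
  classical
  induction t using Finset.induction_on with
  | empty => simpa using dependsOnHist_const (0 : ℝ)
  | insert a t ha ih =>
    have h1 := (h a (Finset.mem_insert_self a t)).comp₂
      (ih fun b hb => h b (Finset.mem_insert_of_mem hb)) (· + ·)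
    simpa only [Finset.sum_insert ha] using h1

lemma DependsOnHist.exists_bound {g : Ω → ℝ} (h : DependsOnHist i k g) : ∃ B, ∀ ω, g ω ≤ B := by
  obtain ⟨X, hX⟩ := h
  obtain ⟨B, hB⟩ := (Set.finite_range X).bddAbove
  exact ⟨B, fun ω => (hX ω).trans_le (hB ⟨_, rfl⟩)⟩

variable [MeasurableSpace Ω] {μ : Measure Ω}

lemma measurable_hist (hi : ∀ k, Measurable (i k)) (k : ℕ) : Measurable (hist i k) :=
  measurable_pi_lambda _ fun q => hi q

lemma DependsOnHist.measurableSet (hi : ∀ k, Measurable (i k)) {s : Set Ω}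
    (h : DependsOnHist i k (· ∈ s)) : MeasurableSet s := by
  obtain ⟨X, hX⟩ := h
  have : s = hist i k ⁻¹' {a | X a} := by
    ext ω
    exact iff_of_eq (hX ω)
  rw [this]
  exact measurable_hist hi k (Set.toFinite _).measurableSet

/-- A function of finitely many indices takes finitely many values, so no measurability of gradients
or of the proximal map is needed. -/
lemma DependsOnHist.integrable [IsFiniteMeasure μ] (hi : ∀ k, Measurable (i k)) {g : Ω → ℝ}
    (h : DependsOnHist i k g) : Integrable g μ := by
  obtain ⟨X, hX⟩ := h
  rw [show g = X ∘ hist i k from funext hX]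
  exact Integrable.comp_measurable (Integrable.of_finite) (measurable_hist hi k)

/-- The filtration generated by the indices sampled before the `ℓ`-th inner loop. -/
def histFiltration (hi : ∀ k, Measurable (i k)) (P : ℕ) :
    Filtration ℕ (inferInstance : MeasurableSpace Ω) where
  seq ℓ := MeasurableSpace.comap (hist i (ℓ * P)) inferInstance
  mono' := by
    intro a b hab s hs
    obtain ⟨S, hS, rfl⟩ := hs
    have hle : a * P ≤ b * P := Nat.mul_le_mul_right P hab
    refine ⟨(fun (h : Finset.range (b * P) → Fin m) (q : Finset.range (a * P)) =>
      h ⟨q, Finset.range_subset_range.2 hle q.2⟩) ⁻¹' S, (Set.toFinite _).measurableSet, rfl⟩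
  le' := fun ℓ => (measurable_hist hi (ℓ * P)).comap_le

lemma dependsOnHist_of_measurableSet (hi : ∀ k, Measurable (i k)) {P ℓ : ℕ} {s : Set Ω}
    (hs : MeasurableSet[histFiltration hi P ℓ] s) : DependsOnHist i (ℓ * P) (· ∈ s) := by
  obtain ⟨S, _, rfl⟩ := hs
  exact ⟨fun a => a ∈ S, fun ω => rfl⟩

lemma DependsOnHist.stronglyMeasurable (hi : ∀ k, Measurable (i k)) {P ℓ : ℕ} {g : Ω → ℝ}
    (h : DependsOnHist i (ℓ * P) g) : StronglyMeasurable[histFiltration hi P ℓ] g := by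
  obtain ⟨X, hX⟩ := h
  rw [show g = X ∘ hist i (ℓ * P) from funext hX]
  exact (measurable_of_finite X).stronglyMeasurable.comp_measurable
    (comap_measurable (hist i (ℓ * P)))

/-- The samples are independent and uniform. -/
structure IsUniformSampling (i : ℕ → Ω → Fin m) (μ : Measure Ω) : Prop where
  meas : ∀ k, Measurable (i k)
  indep : iIndepFun i μ
  unif : ∀ k j, μ.real (i k ⁻¹' {j}) = 1 / (m : ℝ)

lemma IsUniformSampling.indepFun_hist (hi : IsUniformSampling i μ) (k : ℕ) :
    IndepFun (hist i k) (i k) μ := by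
  have h := hi.indep.indepFun_finset (Finset.range k) {k} (by simp) hi.meas
  exact h.comp (φ := id) (ψ := fun a : (({k} : Finset ℕ) → Fin m) =>
    a ⟨k, Finset.mem_singleton_self k⟩) measurable_id (measurable_pi_apply _)

/-- Averaging over the newly sampled index. -/
lemma IsUniformSampling.setIntegral_eq [IsProbabilityMeasure μ] (hi : IsUniformSampling i μ)
    {s : Set Ω} (hs : DependsOnHist i k (· ∈ s)) {g : Fin m → Ω → ℝ}
    (hg : ∀ j, DependsOnHist i k (g j)) :
    ∫ ω in s, g (i k ω) ω ∂μ = ∫ ω in s, (1 / (m : ℝ)) * ∑ j, g j ω ∂μ := by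
  have hsm := hs.measurableSet hi.meas
  have hG : ∀ j, DependsOnHist i k (s.indicator (g j)) := by
    intro j
    classical
    have h1 := hs.comp₂ (hg j) (fun p y => if p then y else 0)
    have e : s.indicator (g j) = fun ω => if ω ∈ s then g j ω else 0 := by
      ext ω
      simp only [Set.indicator_apply]
    rw [e]
    exact h1
  -- The integrand splits over the value of the new index; each indicator `I j` is independent of
  -- the history, on which `s` and `g j` depend.
  set I : Fin m → Ω → ℝ := fun j ω => if i k ω = j then 1 else 0 with hI
  have hId : ∀ j, DependsOnHist i (k + 1) (I j) := fun j =>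
    dependsOnHist_sample.comp (fun a => if a = j then (1 : ℝ) else 0)
  have hint : ∀ j, ∫ ω, I j ω * s.indicator (g j) ω ∂μ
      = (1 / (m : ℝ)) * ∫ ω, s.indicator (g j) ω ∂μ := by
    intro j
    obtain ⟨X, hX⟩ := hG j
    have hind : IndepFun (I j) (s.indicator (g j)) μ := by
      have h1 := (hi.indepFun_hist k).symm.comp (φ := fun a => if a = j then (1 : ℝ) else 0)
        (ψ := X) (measurable_of_finite _) (measurable_of_finite _)
      rw [show s.indicator (g j) = X ∘ hist i k from funext hX]
      exact h1
    have h2 := hind.integral_mul_eq_mul_integral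
      ((hId j).integrable hi.meas).aestronglyMeasurable
      ((hG j).integrable hi.meas).aestronglyMeasurable
    simp only [Pi.mul_apply] at h2
    rw [h2]
    congr 1
    have e : I j = (i k ⁻¹' {j}).indicator 1 := by
      ext ω
      by_cases h : i k ω = j <;> simp [hI, h, Set.indicator]
    rw [e, integral_indicator_one (hi.meas k (measurableSet_singleton j)), hi.unif]
  rw [← integral_indicator hsm, ← integral_indicator hsm]
  have e1 : s.indicator (fun ω => g (i k ω) ω) = fun ω => ∑ j, I j ω * s.indicator (g j) ω := by
    ext ω
    by_cases h : ω ∈ s <;> simp [hI, h]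
  have e2 : s.indicator (fun ω => (1 / (m : ℝ)) * ∑ j, g j ω)
      = fun ω => ∑ j, (1 / (m : ℝ)) * s.indicator (g j) ω := by
    ext ω
    by_cases h : ω ∈ s <;> simp [h, Finset.mul_sum]
  rw [e1, e2, integral_finsetSum _ fun j _ => ?_, integral_finsetSum _ fun j _ => ?_]
  · refine Finset.sum_congr rfl fun j _ => ?_
    rw [hint, integral_const_mul]
  · exact ((hG j).integrable hi.meas).const_mul _
  · exact (((hId j).comp₂ ((hG j).mono k.le_succ) (· * ·))).integrable hi.meas

end Sampling

/-! ### The inner loop in expectation. -/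

section Iterates

variable {E : Type*} [NormedAddCommGroup E] [InnerProductSpace ℝ E] [CompleteSpace E]
  {Ω : Type*} {m : ℕ} {R : E → EReal} {F : E → ℝ} {F' : E → E} {φ : Fin m → E → E} {L γ : ℝ}
  {P : ℕ} {i : ℕ → Ω → Fin m} {x : ℕ → ℕ → Ω → E} {xs : E}

/-- The iterates of Prox-SVRG as random variables. -/
structure IsSVRGProcess (R : E → EReal) (F' : E → E) (φ : Fin m → E → E) (γ : ℝ) (P : ℕ)
    (i : ℕ → Ω → Fin m) (x : ℕ → ℕ → Ω → E) : Prop where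
  start : ∃ a, ∀ ω, x 0 0 ω = a
  epoch : ∀ ω ℓ, IsEpoch R F' φ γ P (fun p => i (ℓ * P + p) ω) (fun p => x ℓ p ω)
  next : ∀ ω ℓ, x (ℓ + 1) 0 ω = x ℓ P ω

lemma IsSVRGProcess.dependsOnHist (h : SVRGData R F F' φ L γ P)
    (hx : IsSVRGProcess R F' φ γ P i x) (hex : ∀ z, ∃ y, IsProx R γ z y) :
    ∀ ℓ, ∀ p ≤ P, DependsOnHist i (ℓ * P + p) (x ℓ p) := by
  choose Pr hPr using hex
  have hinner : ∀ ℓ, DependsOnHist i (ℓ * P) (x ℓ 0) →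
      ∀ p ≤ P, DependsOnHist i (ℓ * P + p) (x ℓ p) := by
    intro ℓ h0 p hp
    induction p with
    | zero => exact h0
    | succ p ih =>
      have h1 := (ih (Nat.le_of_succ_le hp)).mono (Nat.le_succ _)
      have h2 := h0.mono (show ℓ * P ≤ ℓ * P + p + 1 by omega)
      have h3 : DependsOnHist i (ℓ * P + p + 1) (i (ℓ * P + p)) := dependsOnHist_sample
      have h4 := (h1.comp₂ h2 Prod.mk).comp₂ h3 fun q k =>
        Pr (q.1 - γ • (φ k q.1 - φ k q.2 + F' q.2))
      obtain ⟨X, hX⟩ := h4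
      refine ⟨X, fun ω => Eq.trans ?_ (hX ω)⟩
      exact (hx.epoch ω ℓ p hp).unique h.convex h.gamma_pos (hPr _)
  intro ℓ
  induction ℓ with
  | zero =>
    obtain ⟨a, ha⟩ := hx.start
    exact hinner 0 ⟨fun _ => a, ha⟩
  | succ ℓ ih =>
    refine hinner _ ?_
    obtain ⟨X, hX⟩ := ih P le_rfl
    rw [Nat.succ_mul]
    exact ⟨X, fun ω => (hx.next ω ℓ).trans (hX ω)⟩

variable [MeasurableSpace Ω] {μ : Measure Ω} [IsProbabilityMeasure μ]

lemma IsSVRGProcess.setIntegral_step_le [NeZero m] (h : SVRGData R F F' φ L γ P)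
    (hx : IsSVRGProcess R F' φ γ P i x) (hi : IsUniformSampling i μ)
    (hex : ∀ z, ∃ y, IsProx R γ z y) (hxs : R xs ≠ ⊤) {ℓ p : ℕ} (hp : p < P) {s : Set Ω}
    (hs : DependsOnHist i (ℓ * P + p) (· ∈ s)) :
    ∫ ω in s, (‖x ℓ (p + 1) ω - xs‖ ^ 2 + 2 * γ * gap R F xs (x ℓ (p + 1) ω)
        + (1 - 2 * γ * L) * ‖x ℓ (p + 1) ω - x ℓ p ω‖ ^ 2) ∂μ
      ≤ ∫ ω in s, (‖x ℓ p ω - xs‖ ^ 2 + 2 * γ ^ 2 * L ^ 2 * ‖x ℓ p ω - x ℓ 0 ω‖ ^ 2) ∂μ := by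
  have hdep := hx.dependsOnHist h hex ℓ
  choose Pr hPr using hex
  set y : Fin m → Ω → E := fun j ω =>
    Pr (x ℓ p ω - γ • (φ j (x ℓ p ω) - φ j (x ℓ 0 ω) + F' (x ℓ 0 ω))) with hy
  set g : Fin m → Ω → ℝ := fun j ω => ‖y j ω - xs‖ ^ 2 + 2 * γ * gap R F xs (y j ω)
        + (1 - 2 * γ * L) * ‖y j ω - x ℓ p ω‖ ^ 2 with hg
  have hxp := hdep p hp.le
  have hx0 : DependsOnHist i (ℓ * P + p) (x ℓ 0) :=
    (hdep 0 (Nat.zero_le _)).mono (Nat.add_le_add_left (Nat.zero_le _) _)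
  have hyd : ∀ j, DependsOnHist i (ℓ * P + p) (y j) := fun j =>
    hxp.comp₂ hx0 fun a b => Pr (a - γ • (φ j a - φ j b + F' b))
  have hgd : ∀ j, DependsOnHist i (ℓ * P + p) (g j) := fun j =>
    (hyd j).comp₂ hxp fun a b => ‖a - xs‖ ^ 2 + 2 * γ * gap R F xs a
        + (1 - 2 * γ * L) * ‖a - b‖ ^ 2
  have hstep : ∀ ω, x ℓ (p + 1) ω = y (i (ℓ * P + p) ω) ω := fun ω =>
    (hx.epoch ω ℓ p hp).unique h.convex h.gamma_pos (hPr _)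
  simp only [hstep]
  change ∫ ω in s, g (i (ℓ * P + p) ω) ω ∂μ ≤ _
  rw [hi.setIntegral_eq hs hgd]
  refine setIntegral_mono ?_ ?_ fun ω => ?_
  · exact ((DependsOnHist.sum fun j _ => hgd j).integrable hi.meas |>.const_mul _).integrableOn
  · exact ((hxp.comp₂ hx0 fun a b => ‖a - xs‖ ^ 2 + 2 * γ ^ 2 * L ^ 2 * ‖a - b‖ ^ 2).integrable
      hi.meas).integrableOn
  · exact sum_prox_step_le h.convex h.gamma_pos h.gradient_le h.lip h.lip_term h.mean hxs
      (fun z => ⟨_, hPr z⟩) fun j => hPr _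

/-- The one-step bounds telescope. Each noise term is measured from the snapshot, so the full step
sum appears on the right even when the loop is entered at `p₀ > 0`. Integrating over events of the
past takes the place of conditional expectation. -/
lemma IsSVRGProcess.setIntegral_epoch_le [NeZero m] (h : SVRGData R F F' φ L γ P)
    (hx : IsSVRGProcess R F' φ γ P i x) (hi : IsUniformSampling i μ)
    (hex : ∀ z, ∃ y, IsProx R γ z y) (hxs : R xs ≠ ⊤) {ℓ p₀ : ℕ} (hp₀ : p₀ ≤ P) {s : Set Ω}
    (hs : DependsOnHist i (ℓ * P + p₀) (· ∈ s)) :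
    ∫ ω in s, (‖x ℓ P ω - xs‖ ^ 2 + ∑ q ∈ Finset.Ico p₀ P,
        (2 * γ * gap R F xs (x ℓ (q + 1) ω) + 3 / 4 * ‖x ℓ (q + 1) ω - x ℓ q ω‖ ^ 2)) ∂μ
      ≤ ∫ ω in s, (‖x ℓ p₀ ω - xs‖ ^ 2
        + (4 * L * γ * (P + 1)) ^ 2 / 8 * stepSum P (fun p => x ℓ p ω)) ∂μ := by
  have hdep : ∀ p ≤ P, DependsOnHist i (ℓ * P + P) (x ℓ p) := fun p hp =>
    (hx.dependsOnHist h hex ℓ p hp).mono (Nat.add_le_add_left hp _)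
  set w : ℕ → Ω → ℝ := fun q ω =>
    2 * γ * gap R F xs (x ℓ (q + 1) ω) + 3 / 4 * ‖x ℓ (q + 1) ω - x ℓ q ω‖ ^ 2 with hw
  set S : Ω → ℝ := fun ω => stepSum P (fun p => x ℓ p ω) with hS
  have hwd : ∀ q < P, DependsOnHist i (ℓ * P + P) (w q) := fun q hq =>
    (hdep (q + 1) hq).comp₂ (hdep q hq.le) fun a b =>
      2 * γ * gap R F xs a + 3 / 4 * ‖a - b‖ ^ 2
  have hSd : DependsOnHist i (ℓ * P + P) S := DependsOnHist.sum fun q hq =>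
    (hdep (q + 1) (Finset.mem_range.1 hq)).comp₂ (hdep q (Finset.mem_range.1 hq).le)
      fun a b => ‖a - b‖ ^ 2
  have hud : ∀ p ≤ P, DependsOnHist i (ℓ * P + P) (fun ω => ‖x ℓ p ω - xs‖ ^ 2) := fun p hp =>
    (hdep p hp).comp fun a => ‖a - xs‖ ^ 2
  have hint : ∀ {g : Ω → ℝ}, DependsOnHist i (ℓ * P + P) g → IntegrableOn g s μ := fun hg =>
    (hg.integrable hi.meas).integrableOn
  set κ' := 2 * γ ^ 2 * L ^ 2 * P with hκ'
  have hκ'0 : 0 ≤ κ' := by positivity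
  have hind : ∀ p, p₀ ≤ p → p ≤ P →
      ∫ ω in s, (‖x ℓ p ω - xs‖ ^ 2 + ∑ q ∈ Finset.Ico p₀ p, w q ω) ∂μ
        ≤ ∫ ω in s, (‖x ℓ p₀ ω - xs‖ ^ 2 + p * (κ' * S ω)) ∂μ := by
    intro p hp₀p
    induction p, hp₀p using Nat.le_induction with
    | base =>
      intro _
      refine setIntegral_mono (hint ?_) (hint ?_) fun ω => ?_
      · simpa using hud p₀ hp₀
      · exact (hud p₀ hp₀).comp₂ hSd fun a b => a + p₀ * (κ' * b)
      · simp only [Finset.Ico_self, Finset.sum_empty, add_zero]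
        have : 0 ≤ (p₀ : ℝ) * (κ' * S ω) :=
          mul_nonneg (Nat.cast_nonneg _) (mul_nonneg hκ'0 stepSum_nonneg)
        linarith
    | succ p hp₀p ih =>
      intro hp
      have hpP : p < P := hp
      have h1 := ih hpP.le
      have h2 := hx.setIntegral_step_le h hi hex hxs hpP (hs.mono (Nat.add_le_add_left hp₀p _))
      have hWd : DependsOnHist i (ℓ * P + P) (fun ω => ∑ q ∈ Finset.Ico p₀ p, w q ω) :=
        DependsOnHist.sum fun q hq => hwd q ((Finset.mem_Ico.1 hq).2.trans hpP)
      have h3 : ∫ ω in s, (‖x ℓ (p + 1) ω - xs‖ ^ 2 + w p ω) ∂μ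
          ≤ ∫ ω in s, (‖x ℓ p ω - xs‖ ^ 2 + κ' * S ω) ∂μ := by
        refine le_trans ?_ (h2.trans ?_)
        · refine setIntegral_mono (hint ((hud _ hp).comp₂ (hwd p hpP) (· + ·)))
            (hint ((hdep _ hp).comp₂ (hdep p hpP.le) fun a b => ‖a - xs‖ ^ 2
              + 2 * γ * gap R F xs a + (1 - 2 * γ * L) * ‖a - b‖ ^ 2)) fun ω => ?_
          simp only [hw]
          have : 3 / 4 * ‖x ℓ (p + 1) ω - x ℓ p ω‖ ^ 2
              ≤ (1 - 2 * γ * L) * ‖x ℓ (p + 1) ω - x ℓ p ω‖ ^ 2 :=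
            mul_le_mul_of_nonneg_right (by linarith [h.mul_le_eighth]) (sq_nonneg _)
          linarith
        · refine setIntegral_mono (hint ((hdep p hpP.le).comp₂ (hdep 0 (Nat.zero_le _)) fun a b =>
            ‖a - xs‖ ^ 2 + 2 * γ ^ 2 * L ^ 2 * ‖a - b‖ ^ 2))
            (hint ((hud p hpP.le).comp₂ hSd fun a b => a + κ' * b)) fun ω => ?_
          have := mul_le_mul_of_nonneg_left (sq_dist_start_le (y := fun p => x ℓ p ω) hpP.le)
            (show 0 ≤ 2 * γ ^ 2 * L ^ 2 by positivity)
          simp only [hκ', hS]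
          linarith
      have e1 : ∫ ω in s, (‖x ℓ (p + 1) ω - xs‖ ^ 2 + ∑ q ∈ Finset.Ico p₀ (p + 1), w q ω) ∂μ
          = ∫ ω in s, (‖x ℓ (p + 1) ω - xs‖ ^ 2 + w p ω) ∂μ
            + ∫ ω in s, ∑ q ∈ Finset.Ico p₀ p, w q ω ∂μ := by
        rw [← integral_add (hint ((hud _ hp).comp₂ (hwd p hpP) (· + ·))) (hint hWd)]
        refine integral_congr_ae (Eventually.of_forall fun ω => ?_)
        simp only [Finset.sum_Ico_succ_top hp₀p]
        ring
      have e2 : ∫ ω in s, (‖x ℓ p₀ ω - xs‖ ^ 2 + (p + 1 : ℕ) * (κ' * S ω)) ∂μ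
          = ∫ ω in s, (‖x ℓ p₀ ω - xs‖ ^ 2 + p * (κ' * S ω)) ∂μ + ∫ ω in s, κ' * S ω ∂μ := by
        rw [← integral_add (hint ((hud p₀ hp₀).comp₂ hSd fun a b => a + p * (κ' * b)))
          (hint (hSd.comp fun b => κ' * b))]
        refine integral_congr_ae (Eventually.of_forall fun ω => ?_)
        simp only
        push_cast
        ring
      rw [integral_add (hint (hud p hpP.le)) (hint (hSd.comp fun b => κ' * b))] at h3
      rw [integral_add (hint (hud p hpP.le)) (hint hWd)] at h1
      rw [e1, e2]
      linarith
  refine (hind P hp₀ le_rfl).trans ?_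
  refine setIntegral_mono (hint ((hud p₀ hp₀).comp₂ hSd fun a b => a + P * (κ' * b)))
    (hint ((hud p₀ hp₀).comp₂ hSd fun a b => a + (4 * L * γ * (P + 1)) ^ 2 / 8 * b)) fun ω => ?_
  -- `P κ' = 2γ²L²P²`, while the right side is `2γ²L²(P + 1)²`.
  have h1 : P * κ' ≤ (4 * L * γ * (P + 1)) ^ 2 / 8 := by
    have e : (4 * L * γ * (P + 1)) ^ 2 / 8 - P * κ' = 2 * γ ^ 2 * L ^ 2 * (2 * P + 1) := by
      rw [hκ']; ring
    have : 0 ≤ 2 * γ ^ 2 * L ^ 2 * (2 * (P : ℝ) + 1) := by positivity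
    linarith
  have h2 := mul_le_mul_of_nonneg_right h1 (stepSum_nonneg (P := P) (y := fun p => x ℓ p ω))
  simp only [hS]
  linarith

end Iterates

/-! ### Almost sure convergence and the expected effect of a loop. -/

section AlmostSure

variable {E : Type*} [NormedAddCommGroup E] [InnerProductSpace ℝ E]
  {Ω : Type*} {m : ℕ} {R : E → EReal} {F : E → ℝ} {F' : E → E} {φ : Fin m → E → E} {L γ : ℝ}
  {P : ℕ} {i : ℕ → Ω → Fin m} {x : ℕ → ℕ → Ω → E} {xs : E}

/-- `y` minimises `R + F`, in terms of real numbers. -/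
def IsRealMinimizer (R : E → EReal) (F : E → ℝ) (y : E) : Prop :=
  R y ≠ ⊤ ∧ ∀ z, R z ≠ ⊤ → 0 ≤ gap R F y z

/-- Opial's argument for a sequence that is minimising and Fejér monotone in the limit. -/
lemma exists_tendsto_of_fejer [FiniteDimensional ℝ E] (hR : IsProperConvexLsc R)
    (hF : Continuous F) {D : Set E} {y₀ : E}
    (hy₀ : y₀ ∈ D) (hmin : ∀ y ∈ D, IsRealMinimizer R F y)
    (hdense : ∀ y, IsRealMinimizer R F y → y ∈ closure D) {z : ℕ → E}
    (hconv : ∀ y ∈ D, ∃ c, Tendsto (fun ℓ => ‖z ℓ - y‖) atTop (𝓝 c))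
    (hfin : ∀ ℓ, R (z (ℓ + 1)) ≠ ⊤)
    (hgap : Tendsto (fun ℓ => gap R F y₀ (z (ℓ + 1))) atTop (𝓝 0)) :
    ∃ ys, IsRealMinimizer R F ys ∧ Tendsto z atTop (𝓝 ys) := by
  have : ProperSpace E := FiniteDimensional.proper ℝ E
  obtain ⟨c, hc⟩ := hconv y₀ hy₀
  obtain ⟨B, hB⟩ := hc.bddAbove_range
  obtain ⟨ys, -, ψ, hψ, hlim⟩ := tendsto_subseq_of_bounded
    (Metric.isBounded_closedBall (x := y₀) (r := B)) (x := fun ℓ => z (ℓ + 1))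
    (fun ℓ => mem_closedBall_iff_norm.2 (hB ⟨ℓ + 1, rfl⟩))
  have hy₀m := hmin y₀ hy₀
  -- The excess tends to zero and `F` is continuous, so the values of `R` converge along the
  -- subsequence; lower semicontinuity bounds `R ys` by their limit.
  have hle : R ys ≤ (((R y₀).toReal + F y₀ - F ys : ℝ) : EReal) := by
    by_contra! hlt
    obtain ⟨a, ha1, ha2⟩ := EReal.lt_iff_exists_real_btwn.1 hlt
    have hev := hlim.eventually (hR.lsc ys a ha2)
    have hval : Tendsto (fun ℓ => (R (z (ψ ℓ + 1))).toReal) atTop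
        (𝓝 ((R y₀).toReal + F y₀ - F ys)) := by
      have h1 := hgap.comp hψ.tendsto_atTop
      have h2 := (hF.tendsto ys).comp hlim
      have h3 := (h1.add_const ((R y₀).toReal + F y₀)).sub h2
      rw [zero_add] at h3
      refine h3.congr fun ℓ => ?_
      simp only [gap, Function.comp_apply]
      ring
    have hlt2 := hval.eventually_lt_const (EReal.coe_lt_coe_iff.1 ha1)
    obtain ⟨ℓ, h1, h2⟩ := (hev.and hlt2).exists
    simp only [Function.comp_apply] at h1
    rw [gt_iff_lt, ← hR.coe_toReal (hfin _), EReal.coe_lt_coe_iff] at h1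
    exact lt_asymm h1 h2
  have hysm : IsRealMinimizer R F ys := by
    have htop : R ys ≠ ⊤ := (hle.trans_lt (EReal.coe_lt_top _)).ne
    refine ⟨htop, fun w hw => ?_⟩
    rw [← hR.coe_toReal htop, EReal.coe_le_coe_iff] at hle
    have := hy₀m.2 w hw
    unfold gap at this ⊢
    linarith
  refine ⟨ys, hysm, ?_⟩
  rw [Metric.tendsto_atTop]
  intro ε hε
  -- Distances are known to converge only for points of `D`, so `ys` is replaced by a nearby `y ∈
  -- D`; the subsequence identifies the limiting distance as that from `ys` to `y`.
  obtain ⟨y, hyD, hyd⟩ := Metric.mem_closure_iff.1 (hdense ys hysm) (ε / 2) (by positivity)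
  obtain ⟨b, hb⟩ := hconv y hyD
  have hsub : Tendsto (fun ℓ => ‖z (ψ ℓ + 1) - y‖) atTop (𝓝 b) :=
    hb.comp ((tendsto_add_atTop_nat 1).comp hψ.tendsto_atTop)
  have hsub2 : Tendsto (fun ℓ => ‖z (ψ ℓ + 1) - y‖) atTop (𝓝 ‖ys - y‖) :=
    (hlim.sub_const y).norm
  rw [tendsto_nhds_unique hsub hsub2, ← dist_eq_norm] at hb
  obtain ⟨N, hN⟩ := eventually_atTop.1 (hb.eventually_lt_const hyd)
  refine ⟨N, fun ℓ hℓ => ?_⟩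
  have h1 := hN ℓ hℓ
  rw [← dist_eq_norm] at h1
  have h2 := dist_triangle_right (z ℓ) ys y
  linarith

/-- The weighted decrease over an inner loop. -/
noncomputable def decrease (R : E → EReal) (F : E → ℝ) (γ : ℝ) (P : ℕ) (xs : E) (y : ℕ → E) : ℝ :=
  ∑ q ∈ Finset.range P, (2 * γ * gap R F xs (y (q + 1)) + 1 / 2 * ‖y (q + 1) - y q‖ ^ 2)

lemma IsEpoch.stepSum_le_decrease (h : SVRGData R F F' φ L γ P) {j : ℕ → Fin m} {y : ℕ → E}
    (hy : IsEpoch R F' φ γ P j y) (hmin : IsRealMinimizer R F xs) :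
    1 / 2 * stepSum P y ≤ decrease R F γ P xs y := by
  unfold stepSum decrease
  rw [Finset.mul_sum]
  refine Finset.sum_le_sum fun q hq => ?_
  have := hmin.2 _ (hy.ne_top h (Finset.mem_range.1 hq))
  have h2 := mul_nonneg (mul_nonneg zero_le_two h.gamma_pos.le) this
  linarith

lemma IsEpoch.gap_le_decrease (h : SVRGData R F F' φ L γ P) {j : ℕ → Fin m} {y : ℕ → E}
    (hy : IsEpoch R F' φ γ P j y) (hmin : IsRealMinimizer R F xs) :
    2 * γ * gap R F xs (y P) ≤ decrease R F γ P xs y := by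
  obtain ⟨q, rfl⟩ : ∃ q, P = q + 1 := ⟨P - 1, (Nat.succ_pred_eq_of_pos h.length_pos).symm⟩
  have h1 : ∀ p ∈ Finset.range (q + 1),
      0 ≤ 2 * γ * gap R F xs (y (p + 1)) + 1 / 2 * ‖y (p + 1) - y p‖ ^ 2 := by
    intro p hp
    have := hmin.2 _ (hy.ne_top h (Finset.mem_range.1 hp))
    have h2 := mul_nonneg (mul_nonneg zero_le_two h.gamma_pos.le) this
    positivity
  have h2 := Finset.single_le_sum h1 (Finset.self_mem_range_succ q)
  have h3 : 0 ≤ 1 / 2 * ‖y (q + 1) - y q‖ ^ 2 := by positivity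
  unfold decrease
  linarith

variable [MeasurableSpace Ω] {μ : Measure Ω} [IsProbabilityMeasure μ]

/-- Nonnegativity turns the `L¹` norm into an expectation, which is at most the initial one; the
submartingale convergence theorem then applies to `-S`. -/
lemma ae_tendsto_of_supermartingale {ℱ : Filtration ℕ (inferInstance : MeasurableSpace Ω)}
    {S : ℕ → Ω → ℝ} (hS : Supermartingale S ℱ μ) (h0 : ∀ n ω, 0 ≤ S n ω) :
    ∀ᵐ ω ∂μ, ∃ c, Tendsto (fun n => S n ω) atTop (𝓝 c) := by
  have hbd : ∀ n, eLpNorm ((-S) n) 1 μ ≤ ((∫ ω, S 0 ω ∂μ).toNNReal : ENNReal) := by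
    intro n
    have h1 : eLpNorm ((-S) n) 1 μ = ENNReal.ofReal (∫ ω, S n ω ∂μ) := by
      rw [Pi.neg_apply, eLpNorm_neg, eLpNorm_one_eq_lintegral_enorm,
        ofReal_integral_eq_lintegral_ofReal (hS.integrable n) (Eventually.of_forall (h0 n))]
      refine lintegral_congr fun ω => ?_
      exact Real.enorm_of_nonneg (h0 n ω)
    rw [h1]
    refine ENNReal.ofReal_le_ofReal ?_
    have := hS.setIntegral_le (Nat.zero_le n) MeasurableSet.univ
    simpa using this
  filter_upwards [hS.neg.ae_tendsto_limitProcess hbd] with ω hω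
  exact ⟨_, by simpa using hω.neg⟩

/-- The process `u ℓ` plus all earlier decreases is a nonnegative supermartingale. Its convergence
makes the decreases summable, and then `u ℓ` converges as a difference of convergent sequences. -/
lemma IsSVRGProcess.ae_fejer [CompleteSpace E] [NeZero m] (h : SVRGData R F F' φ L γ P)
    (hx : IsSVRGProcess R F' φ γ P i x) (hi : IsUniformSampling i μ)
    (hex : ∀ z, ∃ y, IsProx R γ z y) (hmin : IsRealMinimizer R F xs) :
    ∀ᵐ ω ∂μ, (∃ c, Tendsto (fun ℓ => ‖x ℓ 0 ω - xs‖) atTop (𝓝 c)) ∧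
      Tendsto (fun ℓ => decrease R F γ P xs (fun p => x ℓ p ω)) atTop (𝓝 0) := by
  have hdep := hx.dependsOnHist h hex
  set u : ℕ → Ω → ℝ := fun ℓ ω => ‖x ℓ 0 ω - xs‖ ^ 2 with hu
  set W : ℕ → Ω → ℝ := fun ℓ ω => decrease R F γ P xs (fun p => x ℓ p ω) with hW
  have hW0 : ∀ ℓ ω, 0 ≤ W ℓ ω := fun ℓ ω =>
    (by have := stepSum_nonneg (P := P) (y := fun p => x ℓ p ω); positivity :
      0 ≤ 1 / 2 * stepSum P (fun p => x ℓ p ω)).trans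
        ((hx.epoch ω ℓ).stepSum_le_decrease h hmin)
  have hud : ∀ ℓ, DependsOnHist i (ℓ * P) (u ℓ) := fun ℓ =>
    (hdep ℓ 0 (Nat.zero_le _)).comp fun a => ‖a - xs‖ ^ 2
  have hWd : ∀ ℓ, DependsOnHist i ((ℓ + 1) * P) (W ℓ) := by
    intro ℓ
    refine DependsOnHist.sum fun q hq => ?_
    have hq := Finset.mem_range.1 hq
    refine ((hdep ℓ (q + 1) hq).mono ?_).comp₂ ((hdep ℓ q hq.le).mono ?_) fun a b =>
      2 * γ * gap R F xs a + 1 / 2 * ‖a - b‖ ^ 2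
    all_goals rw [Nat.succ_mul]; omega
  set S : ℕ → Ω → ℝ := fun ℓ ω => u ℓ ω + ∑ k ∈ Finset.range ℓ, W k ω with hS
  have hSd : ∀ ℓ, DependsOnHist i (ℓ * P) (S ℓ) := fun ℓ =>
    (hud ℓ).comp₂ (DependsOnHist.sum fun k hk =>
      (hWd k).mono (Nat.mul_le_mul_right P (Finset.mem_range.1 hk))) (· + ·)
  have hstep : ∀ ℓ, ∀ s, DependsOnHist i (ℓ * P) (· ∈ s) →
      ∫ ω in s, (u (ℓ + 1) ω + W ℓ ω) ∂μ ≤ ∫ ω in s, u ℓ ω ∂μ := by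
    intro ℓ s hs
    have h1 := hx.setIntegral_epoch_le (ℓ := ℓ) (p₀ := 0) h hi hex hmin.1 (Nat.zero_le _) hs
    have hdP : ∀ p ≤ P, DependsOnHist i ((ℓ + 1) * P) (x ℓ p) := fun p hp =>
      (hdep ℓ p hp).mono (by rw [Nat.succ_mul]; omega)
    set a : Ω → ℝ := fun ω => ‖x ℓ P ω - xs‖ ^ 2 + ∑ q ∈ Finset.Ico 0 P,
        (2 * γ * gap R F xs (x ℓ (q + 1) ω) + 3 / 4 * ‖x ℓ (q + 1) ω - x ℓ q ω‖ ^ 2)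
    set b : Ω → ℝ := fun ω => (4 * L * γ * (P + 1)) ^ 2 / 8 * stepSum P (fun p => x ℓ p ω)
    have hb : DependsOnHist i ((ℓ + 1) * P) b := by
      refine (DependsOnHist.sum (g := fun q ω => ‖x ℓ (q + 1) ω - x ℓ q ω‖ ^ 2)
        fun q hq => ?_).comp (fun t => (4 * L * γ * (P + 1)) ^ 2 / 8 * t)
      have hq := Finset.mem_range.1 hq
      exact (hdP (q + 1) hq).comp₂ (hdP q hq.le) fun a b => ‖a - b‖ ^ 2
    have ha : DependsOnHist i ((ℓ + 1) * P) a := by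
      refine ((hdP P le_rfl).comp fun a => ‖a - xs‖ ^ 2).comp₂
        (DependsOnHist.sum fun q hq => ?_) (· + ·)
      have hq := (Finset.mem_Ico.1 hq).2
      exact (hdP (q + 1) hq).comp₂ (hdP q hq.le) fun a b =>
        2 * γ * gap R F xs a + 3 / 4 * ‖a - b‖ ^ 2
    have h2 : ∫ ω in s, (u (ℓ + 1) ω + W ℓ ω) ∂μ ≤ ∫ ω in s, (a ω - b ω) ∂μ := by
      refine setIntegral_mono (((hud _).comp₂ (hWd ℓ) (· + ·)).integrable hi.meas).integrableOn
        ((ha.comp₂ hb (· - ·)).integrable hi.meas).integrableOn fun ω => ?_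
      simp only [a, b, hu, hW, decrease, stepSum, hx.next, Finset.mul_sum]
      rw [← Finset.range_eq_Ico, add_sub_assoc, ← Finset.sum_sub_distrib]
      gcongr with q hq
      -- The noise takes at most `1/8` out of the gain `3/4`, so the `1/2` in `decrease` remains.
      have h3 : (4 * L * γ * (P + 1)) ^ 2 ≤ 1 :=
        pow_le_one₀ (by have := h.lip_nonneg; have := h.gamma_pos; positivity) h.step_lt.le
      have h4 := mul_le_mul_of_nonneg_right h3 (sq_nonneg ‖x ℓ (q + 1) ω - x ℓ q ω‖)
      nlinarith [sq_nonneg ‖x ℓ (q + 1) ω - x ℓ q ω‖]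
    rw [integral_sub (ha.integrable hi.meas).integrableOn (hb.integrable hi.meas).integrableOn]
      at h2
    rw [integral_add ((hud ℓ).integrable hi.meas).integrableOn
      (hb.integrable hi.meas).integrableOn] at h1
    linarith
  have hsup : Supermartingale S (histFiltration hi.meas P) μ := by
    refine supermartingale_of_setIntegral_succ_le (fun ℓ => (hSd ℓ).stronglyMeasurable hi.meas)
      (fun ℓ => (hSd ℓ).integrable hi.meas) fun ℓ s hs => ?_
    have h1 := hstep ℓ s (dependsOnHist_of_measurableSet hi.meas hs)
    have hT : DependsOnHist i (ℓ * P) (fun ω => ∑ k ∈ Finset.range ℓ, W k ω) :=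
      DependsOnHist.sum fun k hk =>
        (hWd k).mono (Nat.mul_le_mul_right P (Finset.mem_range.1 hk))
    have e : ∀ ω, S (ℓ + 1) ω = (u (ℓ + 1) ω + W ℓ ω) + ∑ k ∈ Finset.range ℓ, W k ω := by
      intro ω
      simp only [hS, Finset.sum_range_succ]
      ring
    simp only [e]
    rw [integral_add (((hud _).comp₂ (hWd ℓ) (· + ·)).integrable hi.meas).integrableOn
      (hT.integrable hi.meas).integrableOn]
    simp only [hS]
    rw [integral_add ((hud ℓ).integrable hi.meas).integrableOn
      (hT.integrable hi.meas).integrableOn]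
    linarith
  have hS0 : ∀ n ω, 0 ≤ S n ω := fun n ω =>
    add_nonneg (sq_nonneg _) (Finset.sum_nonneg fun k _ => hW0 k ω)
  filter_upwards [ae_tendsto_of_supermartingale hsup hS0] with ω ⟨c, hc⟩
  obtain ⟨B, hB⟩ := hc.bddAbove_range
  have hsum : Summable fun k => W k ω := by
    refine summable_of_sum_range_le (c := B) (fun k => hW0 k ω) fun n => ?_
    have h1 : S n ω ≤ B := hB ⟨n, rfl⟩
    have h2 : 0 ≤ u n ω := sq_nonneg _
    simp only [hS] at h1
    linarith
  refine ⟨⟨√(c - ∑' k, W k ω), ?_⟩, hsum.tendsto_atTop_zero⟩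
  have h1 := hc.sub hsum.hasSum.tendsto_sum_nat
  refine (h1.sqrt).congr fun n => ?_
  simp only [hS, add_sub_cancel_right, hu]
  exact Real.sqrt_sq (norm_nonneg _)

/-- Almost sure convergence of the outer and inner iterates. -/
lemma IsSVRGProcess.ae_tendsto [FiniteDimensional ℝ E] [NeZero m] (h : SVRGData R F F' φ L γ P)
    (hF : Continuous F)
    (hx : IsSVRGProcess R F' φ γ P i x) (hi : IsUniformSampling i μ)
    (hex : ∀ z, ∃ y, IsProx R γ z y) (hne : ∃ y, IsRealMinimizer R F y) :
    ∀ᵐ ω ∂μ, ∃ ys, IsRealMinimizer R F ys ∧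
      Tendsto (fun k : ℕ => x (k / P) (k % P) ω) atTop (𝓝 ys) := by
  have : ProperSpace E := FiniteDimensional.proper ℝ E
  have hγ := h.gamma_pos
  obtain ⟨D, hDA, hDc, hDd⟩ := (TopologicalSpace.IsSeparable.of_separableSpace
    {y | IsRealMinimizer R F y}).exists_countable_dense_subset
  obtain ⟨y₁, hy₁⟩ := hne
  obtain ⟨y₀, hy₀⟩ : D.Nonempty := closure_nonempty_iff.1 ⟨y₁, hDd hy₁⟩
  have hall := (ae_ball_iff hDc).2 fun y hy => hx.ae_fejer h hi hex (hDA hy)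
  filter_upwards [hall] with ω hω
  have hdec := (hω y₀ hy₀).2
  have hfin : ∀ ℓ, R (x (ℓ + 1) 0 ω) ≠ ⊤ := by
    intro ℓ
    rw [hx.next]
    obtain ⟨p, hp⟩ : ∃ p, P = p + 1 := ⟨P - 1, (Nat.succ_pred_eq_of_pos h.length_pos).symm⟩
    have := (hx.epoch ω ℓ).ne_top h (p := p) (by omega)
    rwa [← hp] at this
  have hgap : Tendsto (fun ℓ => gap R F y₀ (x (ℓ + 1) 0 ω)) atTop (𝓝 0) := by
    have h1 : Tendsto (fun ℓ => (2 * γ)⁻¹ * decrease R F γ P y₀ (fun p => x ℓ p ω)) atTop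
        (𝓝 0) := by simpa using hdec.const_mul (2 * γ)⁻¹
    refine squeeze_zero (fun ℓ => (hDA hy₀).2 _ (hfin ℓ)) (fun ℓ => ?_) h1
    rw [inv_mul_eq_div, le_div_iff₀ (by positivity), hx.next]
    linarith [(hx.epoch ω ℓ).gap_le_decrease h (hDA hy₀)]
  obtain ⟨ys, hys, hlim⟩ := exists_tendsto_of_fejer h.convex hF hy₀ (fun y hy => hDA hy)
    (fun y hy => hDd hy) (fun y hy => (hω y hy).1) hfin hgap
  refine ⟨ys, hys, ?_⟩
  have hdiv : Tendsto (fun k : ℕ => k / P) atTop atTop :=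
    Nat.tendsto_div_const_atTop h.length_pos.ne'
  -- Inner iterates follow their snapshot because the step sum is dominated by the vanishing
  -- decrease.
  have hinner : Tendsto (fun k : ℕ => x (k / P) (k % P) ω - x (k / P) 0 ω) atTop (𝓝 0) := by
    have h1 : Tendsto (fun ℓ => √(P * (2 * decrease R F γ P y₀ (fun p => x ℓ p ω)))) atTop
        (𝓝 0) := by simpa using ((hdec.const_mul 2).const_mul (P : ℝ)).sqrt
    refine squeeze_zero_norm (fun k => ?_) (h1.comp hdiv)
    refine Real.le_sqrt_of_sq_le ((sq_dist_start_le (y := fun p => x (k / P) p ω)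
      (Nat.mod_lt k h.length_pos).le).trans ?_)
    have := (hx.epoch ω (k / P)).stepSum_le_decrease h (hDA hy₀)
    gcongr
    linarith
  simpa using hinner.add (hlim.comp hdiv)

/-- One inner loop, started from its first inner iterate, in expectation. -/
lemma IsSVRGProcess.integral_next_le [CompleteSpace E] [NeZero m] (h : SVRGData R F F' φ L γ P)
    (hx : IsSVRGProcess R F' φ γ P i x) (hi : IsUniformSampling i μ)
    (hex : ∀ z, ∃ y, IsProx R γ z y) (hmin : IsRealMinimizer R F xs) (ℓ : ℕ) :
    ∫ ω, ‖x (ℓ + 1) 0 ω - xs‖ ^ 2 ∂μ ≤ ∫ ω, (‖x ℓ 1 ω - xs‖ ^ 2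
      + (4 * L * γ * (P + 1)) ^ 2 / 8 * ‖x ℓ 1 ω - x ℓ 0 ω‖ ^ 2) ∂μ := by
  -- Entering at `p₀ = 1` leaves the noise-free first step to the deterministic estimate. The noise
  -- due to steps `q ≥ 1` is absorbed by their own gain, and only the first step's contribution
  -- remains on the right.
  have h1 := hx.setIntegral_epoch_le (ℓ := ℓ) (p₀ := 1) (s := Set.univ) h hi hex hmin.1
    h.length_pos ⟨fun _ => True, fun _ => by simp⟩
  simp only [Measure.restrict_univ] at h1
  set κ := (4 * L * γ * (P + 1)) ^ 2 / 8 with hκ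
  have hκ0 : 0 ≤ κ := by positivity
  have hκ1 : κ ≤ 3 / 4 := by
    have h3 : (4 * L * γ * (P + 1)) ^ 2 ≤ 1 :=
      pow_le_one₀ (by have := h.lip_nonneg; have := h.gamma_pos; positivity) h.step_lt.le
    linarith
  have hdP : ∀ p ≤ P, DependsOnHist i (ℓ * P + P) (x ℓ p) := fun p hp =>
    (hx.dependsOnHist h hex ℓ p hp).mono (Nat.add_le_add_left hp _)
  set d : ℕ → Ω → ℝ := fun q ω => ‖x ℓ (q + 1) ω - x ℓ q ω‖ ^ 2 with hd
  have hdd : ∀ q < P, DependsOnHist i (ℓ * P + P) (d q) := fun q hq =>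
    (hdP (q + 1) hq).comp₂ (hdP q hq.le) fun a b => ‖a - b‖ ^ 2
  set r : Ω → ℝ := fun ω => κ * ∑ q ∈ Finset.Ico 1 P, d q ω with hr
  have hrd : DependsOnHist i (ℓ * P + P) r :=
    (DependsOnHist.sum fun q hq => hdd q (Finset.mem_Ico.1 hq).2).comp (κ * ·)
  have hud : ∀ p ≤ P, DependsOnHist i (ℓ * P + P) (fun ω => ‖x ℓ p ω - xs‖ ^ 2) := fun p hp =>
    (hdP p hp).comp fun a => ‖a - xs‖ ^ 2
  have hfirst : DependsOnHist i (ℓ * P + P) (fun ω => ‖x ℓ 1 ω - xs‖ ^ 2 + κ * d 0 ω) :=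
    (hud 1 h.length_pos).comp₂ (hdd 0 h.length_pos) fun a b => a + κ * b
  have h2 : ∫ ω, (‖x ℓ P ω - xs‖ ^ 2 + r ω) ∂μ
      ≤ ∫ ω, (‖x ℓ P ω - xs‖ ^ 2 + ∑ q ∈ Finset.Ico 1 P,
        (2 * γ * gap R F xs (x ℓ (q + 1) ω) + 3 / 4 * ‖x ℓ (q + 1) ω - x ℓ q ω‖ ^ 2)) ∂μ := by
    refine integral_mono (((hud P le_rfl).comp₂ hrd (· + ·)).integrable hi.meas)
      (((hud P le_rfl).comp₂ (DependsOnHist.sum fun q hq => ?_) (· + ·)).integrable hi.meas)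
      fun ω => ?_
    · have hq := (Finset.mem_Ico.1 hq).2
      exact (hdP (q + 1) hq).comp₂ (hdP q hq.le) fun a b =>
        2 * γ * gap R F xs a + 3 / 4 * ‖a - b‖ ^ 2
    · simp only [hr, Finset.mul_sum]
      gcongr with q hq
      have h3 := hmin.2 _ ((hx.epoch ω ℓ).ne_top h (Finset.mem_Ico.1 hq).2)
      have h4 := mul_nonneg (mul_nonneg zero_le_two h.gamma_pos.le) h3
      have h5 : κ * d q ω ≤ 3 / 4 * d q ω := mul_le_mul_of_nonneg_right hκ1 (sq_nonneg _)
      simp only [hd] at h5 ⊢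
      linarith
  have h3 : ∫ ω, (‖x ℓ 1 ω - xs‖ ^ 2 + κ * stepSum P (fun p => x ℓ p ω)) ∂μ
      = ∫ ω, (‖x ℓ 1 ω - xs‖ ^ 2 + κ * d 0 ω) ∂μ + ∫ ω, r ω ∂μ := by
    rw [← integral_add (hfirst.integrable hi.meas) (hrd.integrable hi.meas)]
    refine integral_congr_ae (Eventually.of_forall fun ω => ?_)
    simp only [stepSum, hr, hd]
    rw [Finset.range_eq_Ico, Finset.sum_eq_sum_Ico_succ_bot h.length_pos]
    ring
  rw [integral_add ((hud P le_rfl).integrable hi.meas) (hrd.integrable hi.meas)] at h2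
  simp only [hx.next]
  simp only [hd, zero_add] at h3
  linarith

end AlmostSure

/-! ### The finite-sum objective as an instance of the general setting. -/

section Objective

variable {E : Type*} [NormedAddCommGroup E] [InnerProductSpace ℝ E] {m : ℕ} {R : E → EReal}
  {f : Fin m → E → ℝ}

lemma mem_argmin_iff (hR : IsProperConvexLsc R) {y : E} :
    y ∈ argmin (objective R f) ↔ IsRealMinimizer R (avg f) y := by
  constructor
  · intro hy
    have htop : R y ≠ ⊤ := by
      intro h
      obtain ⟨z, hz⟩ := hR.exists_finite
      have h1 := hy z
      rw [objective, objective, h, EReal.top_add_coe, top_le_iff, ← hR.coe_toReal hz,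
        ← EReal.coe_add] at h1
      exact EReal.coe_ne_top _ h1
    refine ⟨htop, fun z hz => ?_⟩
    have h1 := hy z
    rw [objective, objective, ← hR.coe_toReal htop, ← hR.coe_toReal hz, ← EReal.coe_add,
      ← EReal.coe_add, EReal.coe_le_coe_iff] at h1
    unfold gap
    linarith
  · rintro ⟨htop, hmin⟩ z
    unfold objective
    by_cases hz : R z = ⊤
    · rw [hz, EReal.top_add_coe]
      exact le_top
    · have h1 := hmin z hz
      rw [← hR.coe_toReal htop, ← hR.coe_toReal hz, ← EReal.coe_add, ← EReal.coe_add,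
        EReal.coe_le_coe_iff]
      unfold gap at h1
      linarith

/-- Growth inside the ball, and its convex extension outside, exclude a second minimiser; the random
limit is therefore `xs`. -/
lemma IsRealMinimizer.eq_of_growth {F : E → ℝ} {xs : E} (hR : IsProperConvexLsc R)
    (hF : ConvexOn ℝ Set.univ F) (hxs : IsRealMinimizer R F xs) {c r : ℝ} (hc : 0 < c) (hr : 0 < r)
    (hg : ∀ x, ‖x - xs‖ ≤ r → R x ≠ ⊤ → c * ‖x - xs‖ ^ 2 ≤ gap R F xs x) {y : E}
    (hy : IsRealMinimizer R F y) : y = xs := by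
  have h1 : gap R F xs y ≤ 0 := by
    have := hy.2 xs hxs.1
    unfold gap at this ⊢
    linarith
  rw [← sub_eq_zero, ← norm_le_zero_iff]
  by_contra! hpos
  rcases le_or_gt ‖y - xs‖ r with hle | hlt
  · have h2 := hg y hle hy.1
    have : 0 < c * ‖y - xs‖ ^ 2 := by positivity
    linarith
  · have h2 := gap_growth_outside hR hF hxs.1 hr hg hy.1 hlt.le
    have : 0 < c * r * ‖y - xs‖ := by positivity
    linarith

variable [CompleteSpace E]

lemma IsRealMinimizer.neg_gradient_mem {F : E → ℝ} (hR : IsProperConvexLsc R)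
    (hF : Differentiable ℝ F) {y : E} (hy : IsRealMinimizer R F y) :
    -gradient F y ∈ subdiff R y :=
  neg_gradient_mem_subdiff hR (hF y).hasGradientAt hy.1 fun z hz => by
    have := hy.2 z hz
    unfold gap at this
    linarith

lemma differentiable_avg (hf : ∀ i, Differentiable ℝ (f i)) : Differentiable ℝ (avg f) :=
  fun x => (hasGradientAt_avg hf x).differentiableAt

lemma svrgData_of_finiteSum [NeZero m] (hR : IsProperConvexLsc R)
    (hf_convex : ∀ i, ConvexOn ℝ Set.univ (f i)) (hf_diff : ∀ i, Differentiable ℝ (f i))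
    {L : ℝ≥0} (hf_lip : ∀ i, LipschitzWith L (gradient (f i))) {γ : ℝ} {P : ℕ} (hγ : 0 < γ)
    (hP : 0 < P) (hγP : 4 * (L : ℝ) * γ * (P + 1) < 1) :
    SVRGData R (avg f) (gradient (avg f)) (fun j => gradient (f j)) L γ P where
  convex := hR
  gamma_pos := hγ
  lip_nonneg := L.2
  length_pos := hP
  step_lt := hγP
  gradient_le x y := (convexOn_avg hf_convex).add_inner_gradient_le
    (differentiable_avg hf_diff x).hasGradientAt y
  lip_term j x y := by
    simpa only [dist_eq_norm] using (hf_lip j).dist_le_mul x y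
  lip x y := by
    rw [gradient_avg hf_diff, gradient_avg hf_diff, ← smul_sub, ← Finset.sum_sub_distrib]
    exact norm_average_le fun j => by
      simpa only [dist_eq_norm] using (hf_lip j).dist_le_mul x y
  mean x := gradient_avg hf_diff x

end Objective

/-! ### Linear convergence in expectation. -/

section Rate

variable {E : Type*} [NormedAddCommGroup E] [InnerProductSpace ℝ E] [FiniteDimensional ℝ E]
  {Ω : Type*} {m : ℕ} {R : E → EReal} {F : E → ℝ} {φ : Fin m → E → E} {L γ : ℝ}
  {P : ℕ} {i : ℕ → Ω → Fin m} {x : ℕ → ℕ → Ω → E} {xs : E} {M : Set E}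

/-- Under the local assumptions the minimiser is unique, with quadratic growth around it. -/
lemma exists_growth_of_restrictedInjectivity (hR : IsProperConvexLsc R) (hd : Differentiable ℝ F)
    (hF : ConvexOn ℝ Set.univ F)
    (hND : -gradient F xs ∈ intrinsicInterior ℝ (subdiff R xs))
    (hRI : RestrictedInjectivity F (modelSubspace R xs) xs) :
    ∃ c > 0, ∃ r > 0, ∀ x, ‖x - xs‖ ≤ r → R x ≠ ⊤ → c * ‖x - xs‖ ^ 2 ≤ gap R F xs x := by
  have hc : ∀ x y, F x + inner ℝ (gradient F x) (y - x) ≤ F y := fun x y =>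
    hF.add_inner_gradient_le (hd x).hasGradientAt y
  obtain ⟨α, hα, r, hr, hmod⟩ := exists_isRestrictedModulus hc hRI
  obtain ⟨δ, hδ, hball⟩ := exists_ball_of_mem_intrinsicInterior hND
  rw [← vectorSpan_subdiff_eq] at hball
  exact exists_quadratic_growth hR hd hc hRI.1 hα hδ (hmod xs (by simpa using hr.le)) hball

variable [MeasurableSpace Ω] {μ : Measure Ω} [IsProbabilityMeasure μ]

/-- Local linear convergence in expectation. -/
lemma IsSVRGProcess.exists_linear_rate [NeZero m] (h : SVRGData R F (gradient F) φ L γ P)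
    (hx : IsSVRGProcess R (gradient F) φ γ P i x) (hi : IsUniformSampling i μ)
    (hex : ∀ z, ∃ y, IsProx R γ z y) (hmin : IsRealMinimizer R F xs)
    (hd : Differentiable ℝ F) (hF : ConvexOn ℝ Set.univ F) (hM : PartlySmooth R xs M)
    (hND : -gradient F xs ∈ intrinsicInterior ℝ (subdiff R xs))
    (hRI : RestrictedInjectivity F (modelSubspace R xs) xs)
    {αF αR : ℝ} (hαF0 : 0 ≤ αF) (hαR0 : 0 ≤ αR)
    (hαF : IsRestrictedModulus F (modelSubspace R xs) xs αF)
    (hαR : IsStrongModulusAlong R M xs αR) :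
    ∃ K : ℕ, 0 < K ∧ ∃ C : ℝ, ∀ ℓ ≥ K,
      Integrable (fun ω => ‖x ℓ 0 ω - xs‖ ^ 2) μ ∧
      ∫ ω, ‖x ℓ 0 ω - xs‖ ^ 2 ∂μ ≤ C * svrgRate L γ αF αR P ^ (ℓ - K) := by
  have hdep := hx.dependsOnHist h hex
  have hP := h.length_pos
  have hud : ∀ ℓ, DependsOnHist i (ℓ * P + 0) (fun ω => ‖x ℓ 0 ω - xs‖ ^ 2) := fun ℓ =>
    (hdep ℓ 0 (Nat.zero_le _)).comp fun a => ‖a - xs‖ ^ 2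
  obtain ⟨c, hc, r, hr, hg⟩ := exists_growth_of_restrictedInjectivity h.convex hd hF hND hRI
  -- The starting point may lie outside the domain of `R`, so the deterministic estimates start from
  -- `x 1 0`, which takes finitely many values and hence has a uniformly bounded excess.
  obtain ⟨B, hB⟩ := ((hdep 1 0 (Nat.zero_le _)).comp (gap R F xs)).exists_bound
  obtain ⟨N, hN⟩ := exists_uniform_contraction h hF hM hd hRI.1 hmin.2 hND hc hr hg hαF0 hαR0
    hαF hαR B
  have hcon : ∀ ω, ∀ ℓ ≥ N + 1,
      ‖x ℓ 1 ω - xs‖ ^ 2 + (4 * L * γ * (P + 1)) ^ 2 / 8 * ‖x ℓ 1 ω - x ℓ 0 ω‖ ^ 2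
        ≤ svrgRate L γ αF αR P * ‖x ℓ 0 ω - xs‖ ^ 2 := by
    intro ω ℓ hℓ
    obtain ⟨k, rfl⟩ : ∃ k, ℓ = k + 1 := ⟨ℓ - 1, by omega⟩
    refine hN (fun ℓ p => i ((ℓ + 1) * P + p) ω) (fun ℓ p => x (ℓ + 1) p ω)
      (fun ℓ => hx.epoch ω (ℓ + 1)) (fun ℓ => hx.next ω (ℓ + 1)) ?_ (hB ω) k (by omega)
    rw [hx.next]
    obtain ⟨p, hp⟩ : ∃ p, P = p + 1 := ⟨P - 1, (Nat.succ_pred_eq_of_pos hP).symm⟩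
    have := (hx.epoch ω 0).ne_top h (p := p) (by omega)
    rwa [← hp] at this
  have hρ0 : 0 ≤ svrgRate L γ αF αR P := by
    refine le_trans ?_ (le_max_right _ _)
    have := h.lip_nonneg
    have := h.gamma_pos
    positivity
  have hstep : ∀ ℓ ≥ N + 1, ∫ ω, ‖x (ℓ + 1) 0 ω - xs‖ ^ 2 ∂μ
      ≤ svrgRate L γ αF αR P * ∫ ω, ‖x ℓ 0 ω - xs‖ ^ 2 ∂μ := by
    intro ℓ hℓ
    refine (hx.integral_next_le h hi hex hmin ℓ).trans ?_
    rw [← integral_const_mul]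
    refine integral_mono ?_ (((hud ℓ).integrable hi.meas).const_mul _) fun ω => hcon ω ℓ hℓ
    exact (((hdep ℓ 1 hP).comp₂ ((hdep ℓ 0 (Nat.zero_le _)).mono (by omega)) fun a b =>
      ‖a - xs‖ ^ 2 + (4 * L * γ * (P + 1)) ^ 2 / 8 * ‖a - b‖ ^ 2)).integrable hi.meas
  refine ⟨N + 1, Nat.succ_pos N, ∫ ω, ‖x (N + 1) 0 ω - xs‖ ^ 2 ∂μ, fun ℓ hℓ =>
    ⟨(hud ℓ).integrable hi.meas, ?_⟩⟩
  induction ℓ, hℓ using Nat.le_induction with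
  | base => simp
  | succ ℓ hℓ ih =>
    refine (hstep ℓ hℓ).trans ((mul_le_mul_of_nonneg_left ih hρ0).trans_eq ?_)
    rw [Nat.succ_sub hℓ, pow_succ]
    ring

end Rate

/-! ### The proposition. -/

theorem proposition4p3 {n m : ℕ}
    (R : EuclideanSpace ℝ (Fin n) → EReal) (f : Fin m → EuclideanSpace ℝ (Fin n) → ℝ)
    (Lc : Fin m → ℝ≥0) (L : ℝ≥0) (hL : L = Finset.univ.sup Lc)
    (hR : IsProperConvexLsc R)
    (hf_convex : ∀ i, ConvexOn ℝ Set.univ (f i))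
    (hf_diff : ∀ i, Differentiable ℝ (f i))
    (hf_lip : ∀ i, LipschitzWith (Lc i) (gradient (f i)))
    (h_argmin : (argmin (objective R f)).Nonempty)
    (γ : ℝ) (P : ℕ) (hγ : 0 < γ) (hP : 0 < P) (hγP : 4 * (L : ℝ) * γ * (P + 1) < 1)
    {Ω : Type*} [MeasurableSpace Ω] (μ : Measure Ω) [IsProbabilityMeasure μ]
    (i : ℕ → Ω → Fin m) (hi_meas : ∀ k, Measurable (i k)) (hi_indep : iIndepFun i μ)
    (hi_unif : ∀ k j, μ.real (i k ⁻¹' {j}) = 1 / (m : ℝ))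
    (a : EuclideanSpace ℝ (Fin n)) (x : ℕ → ℕ → Ω → EuclideanSpace ℝ (Fin n))
    (hx : ∀ ω, IsProxSVRG R f γ P a (fun k => i k ω) (fun ℓ p => x ℓ p ω)) :
    -- almost surely, `x_k = x_{ℓ,p}`, `k = ℓ P + p`, converges to a minimiser
    (∀ᵐ ω ∂μ, ∃ xs ∈ argmin (objective R f),
      Tendsto (fun k : ℕ => x (k / P) (k % P) ω) atTop (𝓝 xs)) ∧
    -- local linear convergence
    (∀ xs ∈ argmin (objective R f), ∀ M : Set (EuclideanSpace ℝ (Fin n)),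
      PartlySmooth R xs M →
      -gradient (avg f) xs ∈ intrinsicInterior ℝ (subdiff R xs) →
      RestrictedInjectivity (avg f) (modelSubspace R xs) xs →
      (∀ᵐ ω ∂μ, Tendsto (fun k : ℕ => x (k / P) (k % P) ω) atTop (𝓝 xs)) ∧
      (∃ αF > 0, IsRestrictedModulus (avg f) (modelSubspace R xs) xs αF) ∧
      ∀ αF αR : ℝ, 0 ≤ αF → 0 ≤ αR →
        IsRestrictedModulus (avg f) (modelSubspace R xs) xs αF →
        IsStrongModulusAlong R M xs αR →
        svrgRate L γ αF αR P < 1 →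
        ∃ K : ℕ, 0 < K ∧ ∃ C : ℝ, ∀ ℓ ≥ K,
          Integrable (fun ω => ‖x ℓ 0 ω - xs‖ ^ 2) μ ∧
          ∫ ω, ‖x ℓ 0 ω - xs‖ ^ 2 ∂μ ≤ C * svrgRate L γ αF αR P ^ (ℓ - K)) := by
  -- A probability space has a point, whose sampled index shows that there is at least one summand.
  have hm : NeZero m := by
    obtain ⟨ω⟩ := nonempty_of_isProbabilityMeasure μ
    exact ⟨fun h0 => (h0 ▸ i 0 ω : Fin 0).elim0⟩
  have hlip : ∀ j, LipschitzWith L (gradient (f j)) := fun j =>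
    (hf_lip j).weaken (hL ▸ Finset.le_sup (Finset.mem_univ j))
  have h := svrgData_of_finiteSum hR hf_convex hf_diff hlip hγ hP hγP
  have hd := differentiable_avg hf_diff
  have hproc : IsSVRGProcess R (gradient (avg f)) (fun j => gradient (f j)) γ P i x :=
    { start := ⟨a, fun ω => (hx ω).init⟩
      epoch := fun ω ℓ p hp => by
        have := (hx ω).step ℓ p hp
        rwa [← gradient_avg hf_diff] at this
      next := fun ω => (hx ω).next }
  have hi : IsUniformSampling i μ := ⟨hi_meas, hi_indep, hi_unif⟩
  obtain ⟨y₀, hy₀⟩ := h_argmin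
  rw [mem_argmin_iff hR] at hy₀
  have hex : ∀ z, ∃ y, IsProx R γ z y := exists_isProx hR hγ (hy₀.neg_gradient_mem hR hd)
  have hconv := hproc.ae_tendsto h hd.continuous hi hex ⟨y₀, hy₀⟩
  refine ⟨?_, fun xs hxs M hM hND hRI => ?_⟩
  · filter_upwards [hconv] with ω hω
    obtain ⟨ys, hys, hlim⟩ := hω
    exact ⟨ys, (mem_argmin_iff hR).2 hys, hlim⟩
  · rw [mem_argmin_iff hR] at hxs
    have hFc := convexOn_avg hf_convex
    refine ⟨?_, exists_isRestrictedModulus h.gradient_le hRI, fun αF αR hαF0 hαR0 hαF hαR _ =>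
      hproc.exists_linear_rate h hi hex hxs hd hFc hM hND hRI hαF0 hαR0 hαF hαR⟩
    obtain ⟨c, hc, r, hr, hg⟩ := exists_growth_of_restrictedInjectivity hR hd hFc hND hRI
    filter_upwards [hconv] with ω hω
    obtain ⟨ys, hys, hlim⟩ := hω
    rwa [hxs.eq_of_growth hR hFc hc hr hg hys] at hlim
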